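/- **Setting.** Let $\mathcal S,\mathcal A$ be sets (states, actions) and let a *transition* be a triple $\xi=(s,a,s')\in\mathcal S\times\mathcal A\times\mathcal S$. A *trajectory of length at most $n$* is a finite sequence $\tau=(\xi_1,\dots,\xi_{|\tau|})$ of transitions with $1\le|\tau|\le n$; a *dataset* is a family $S=(\tau_1,\dots,\tau_m)$ of $m$ such trajectories. Two datasets are neighbouring if they differ in exactly one trajectory. A randomized mechanism $\mathcal M$ on datasets is *$(\epsilon,\delta)$-DP under trajectory* if $\mathbb P(\mathcal M(S)\in Y)\le e^{\epsilon}\,\mathbb P(\mathcal M(\hat S)\in Y)+\delta$ for all neighbouring $S,\hat S$ and all measurable sets $Y$ of outputs. Let $f(\theta,\omega;\xi)$, $\theta,\omega\in\mathbb R^d$, be real-valued and, for every $\xi$, differentiable in $(\theta,\omega)$. **Algorithm (DPTD).** Input: $\nu_t>0$ ($t\ge0$), $\kappa,\eta,\alpha,\beta>0$ with $\nu_t\le 1$, $\alpha\nu_t\le1$, $\beta\nu_t\le1$, sets $\Theta,\Omega\subseteq\mathbb R^d$, points $\theta_0\in\Theta$, $\omega_0\in\Omega$, noise variances $\sigma_t^2$,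 and the number of iterations $T$. Let $\xi_0,\xi_1,\dots$ be sampled independently from the dataset, each by choosing one of the $m$ trajectories uniformly at random and then a transition of it uniformly at random, and let $u^p_t,u^d_t\sim N(0,\sigma_t^2\mathbf I_d)$ be independent of each other and of the samples. Put $p_0=\nabla_\theta f(\theta_0,\omega_0;\xi_0)+u_0^p$, $d_0=\nabla_\omega f(\theta_0,\omega_0;\xi_0)+u_0^d$ and, for $t=0,1,2,\dots$, $$\widetilde\theta_{t+1}=\mathcal P_\Theta(\theta_t-\kappa p_t),\quad \widetilde\omega_{t+1}=\mathcal P_\Omega(\omega_t+\eta d_t),\quad \theta_{t+1}=\theta_t+\nu_t(\widetilde\theta_{t+1}-\theta_t),\quad \omega_{t+1}=\omega_t+\nu_t(\widetilde\omega_{t+1}-\omega_t),$$ $$p_{t+1}=(1-\alpha\nu_t)p_t+\alpha\nu_t\nabla_\theta f(\theta_{t+1},\omega_{t+1};\xi_{t+1})+u^p_{t+1},\quad d_{t+1}=(1-\beta\nu_t)d_t+\beta\nu_t\nabla_\omega f(\theta_{t+1},\omega_{t+1};\xi_{t+1})+u^d_{t+1},$$ where $\mathcal P_K$ is the Euclidean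 projection to $K$. The output $(\bar\theta,\bar\omega)$ is drawn uniformly at random from $(\theta_t,\omega_t)_{t=0}^{T-1}$. **Theorem (Privacy under trajectory).** Assume that $\Theta$ and $\Omega$ are closed and convex and that, for some $G>0$, every trajectory $\tau$ of length $|\tau|\le n$ and all $\theta\in\Theta$, $\omega\in\Omega$ satisfy $$\Big\|\sum_{i=1}^{|\tau|}\nabla_\theta f(\theta,\omega;\xi_i)\Big\|\le nG,\qquad \Big\|\sum_{i=1}^{|\tau|}\nabla_\omega f(\theta,\omega;\xi_i)\Big\|\le nG .$$ Then for all $\epsilon>0$, $\delta>0$ and $\beta'\in(0,1)$, the algorithm is $(\epsilon,\delta)$-DP under trajectory when it is run with the variance $$\sigma_t^2=\frac{14\,n^2G^2T\alpha'}{m^2\left(\epsilon-\frac{\log(1/\delta)}{\alpha'-1}\right)}\quad\text{for all } t\ge0,\qquad \alpha'=\frac{\log(1/\delta)}{(1-\beta')\epsilon}+1,$$ provided that, with $\sigma'^2=\frac{\sigma_t^2}{4n^2G^2}$, $$\sigma'^2\ge 0.7\qquad\text{and}\qquad \alpha'\le \tfrac23\,\sigma_t^2\,\log\!\Big(\frac{n}{\alpha'(1+\sigma'^2)}\Big)+1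 .$$ (For $\delta\ge1$ there is nothing to prove.) -/

import Mathlib

open MeasureTheory ProbabilityTheory
open scoped ENNReal

noncomputable section

namespace DPTD

/-! ### Data -/

/-- A state-action-state triple `ξ = (s, a, s')`. -/
abbrev Transition (𝒮 𝒜 : Type*) := 𝒮 × 𝒜 × 𝒮

/-- A trajectory: a nonempty finite sequence of transitions of length at most `n`. -/
abbrev Trajectory (𝒮 𝒜 : Type*) (n : ℕ) :=
  {τ : List (Transition 𝒮 𝒜) // τ ≠ [] ∧ τ.length ≤ n}

/-- A dataset of `m` trajectories, each of length at most `n`. -/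
abbrev Dataset (𝒮 𝒜 : Type*) (m n : ℕ) := Fin m → Trajectory 𝒮 𝒜 n

/-- Two datasets are neighbouring if they differ in exactly one trajectory. -/
def Neighbouring {𝒮 𝒜 : Type*} {m n : ℕ} (S S' : Dataset 𝒮 𝒜 m n) : Prop :=
  ∃! i, S i ≠ S' i

/-- `(ε, δ)`-differential privacy of the mechanism `M` (given by its output laws) with respect to
the neighbourhood relation `nbr`. -/
def IsDP {X Y : Type*} [MeasurableSpace Y] (nbr : X → X → Prop) (M : X → Measure Y)
    (ε δ : ℝ) : Prop :=
  ∀ x x', nbr x x' → ∀ A, MeasurableSet A →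
    M x A ≤ ENNReal.ofReal (Real.exp ε) * M x' A + ENNReal.ofReal δ

/-- `(ε, δ)`-DP under trajectory. -/
def IsDPUnderTrajectory {𝒮 𝒜 Y : Type*} [MeasurableSpace Y] {m n : ℕ}
    (M : Dataset 𝒮 𝒜 m n → Measure Y) (ε δ : ℝ) : Prop :=
  IsDP Neighbouring M ε δ

/-! ### Gradients, projections, noise -/

abbrev Vec (d : ℕ) := EuclideanSpace ℝ (Fin d)

/-- A stochastic objective `f (θ, ω; ξ)`. -/
abbrev Objective (𝒮 𝒜 : Type*) (d : ℕ) := Vec d → Vec d → Transition 𝒮 𝒜 → ℝ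

/-- `∇_θ f (θ, ω; ξ)`. -/
def gradθ {𝒮 𝒜 : Type*} {d : ℕ} (f : Objective 𝒮 𝒜 d) (θ ω : Vec d) (ξ : Transition 𝒮 𝒜) :
    Vec d :=
  gradient (fun θ' => f θ' ω ξ) θ

/-- `∇_ω f (θ, ω; ξ)`. -/
def gradω {𝒮 𝒜 : Type*} {d : ℕ} (f : Objective 𝒮 𝒜 d) (θ ω : Vec d) (ξ : Transition 𝒮 𝒜) :
    Vec d :=
  gradient (fun ω' => f θ ω' ξ) ω

/-- Averaged `G`-Lipschitz condition: along every trajectory of length at most `n`, the sums of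
the gradients in `θ` and in `ω` are bounded by `n G`, at every point of `Θ × Ω`. -/
def AveragedLipschitz {𝒮 𝒜 : Type*} {d : ℕ} (f : Objective 𝒮 𝒜 d) (Θ Ω : Set (Vec d))
    (n : ℕ) (G : ℝ) : Prop :=
  ∀ τ : Trajectory 𝒮 𝒜 n, ∀ θ ∈ Θ, ∀ ω ∈ Ω,
    ‖(τ.1.map (gradθ f θ ω)).sum‖ ≤ n * G ∧ ‖(τ.1.map (gradω f θ ω)).sum‖ ≤ n * G

/-- The Euclidean projection of `x` to `K`: the point of `K` closest to `x`
(it exists and is unique for closed convex nonempty `K`). -/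
def proj {d : ℕ} (K : Set (Vec d)) (x : Vec d) : Vec d :=
  Classical.epsilon fun y => y ∈ K ∧ ∀ z ∈ K, ‖x - y‖ ≤ ‖x - z‖

theorem proj_spec {d : ℕ} {K : Set (Vec d)} (hne : K.Nonempty) (hcl : IsClosed K)
    (hcv : Convex ℝ K) (x : Vec d) :
    proj K x ∈ K ∧ ∀ z ∈ K, ‖x - proj K x‖ ≤ ‖x - z‖ := by
  obtain ⟨y, hy, h⟩ := exists_norm_eq_iInf_of_complete_convex hne hcl.isComplete hcv x
  refine Classical.epsilon_spec (p := fun y => y ∈ K ∧ ∀ z ∈ K, ‖x - y‖ ≤ ‖x - z‖)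
    ⟨y, hy, fun z hz => ?_⟩
  rw [h]
  exact ciInf_le (f := fun w : K => ‖x - w‖) ⟨0, by rintro _ ⟨w, rfl⟩; exact norm_nonneg _⟩ ⟨z, hz⟩

/-- The Gaussian law `N(0, v I_d)`. -/
def gaussianNoise (d : ℕ) (v : ℝ) : Measure (Vec d) :=
  (stdGaussian (Vec d)).map fun x => Real.sqrt v • x

/-- The law of the pair of independent noises `(u^p, u^d)`, each with law `N(0, v I_d)`. -/
def noisePair (d : ℕ) (v : ℝ) : Measure (Vec d × Vec d) :=
  (gaussianNoise d v).prod (gaussianNoise d v)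

/-- The law of a draw from `F ξ`, where `ξ` is sampled from the dataset: a trajectory of `S` is
drawn uniformly among the `m` trajectories, then `ξ` uniformly among its transitions. -/
def overSample {𝒮 𝒜 X : Type*} [MeasurableSpace X] {m n : ℕ} (S : Dataset 𝒮 𝒜 m n)
    (F : Transition 𝒮 𝒜 → Measure X) : Measure X :=
  ∑ i : Fin m, ∑ j : Fin (S i).1.length,
    ((m : ℝ≥0∞)⁻¹ * ((S i).1.length : ℝ≥0∞)⁻¹) • F ((S i).1.get j)

/-! ### The algorithm -/

/-- Input of the algorithm: step sizes, constants, feasible sets, starting point, and the noise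
variances `σ_t²`. -/
structure Input (d : ℕ) where
  ν : ℕ → ℝ
  κ : ℝ
  η : ℝ
  α : ℝ
  β : ℝ
  Θ : Set (Vec d)
  Ω : Set (Vec d)
  θ₀ : Vec d
  ω₀ : Vec d
  σsq : ℕ → ℝ

/-- The conditions on the input: positive parameters, step sizes for which the updates are convex
combinations, closed convex feasible sets, and a feasible starting point. -/
structure Input.Valid {d : ℕ} (I : Input d) : Prop where
  ν_pos : ∀ t, 0 < I.ν t
  ν_le_one : ∀ t, I.ν t ≤ 1
  κ_pos : 0 < I.κ
  η_pos : 0 < I.η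
  α_pos : 0 < I.α
  β_pos : 0 < I.β
  αν_le_one : ∀ t, I.α * I.ν t ≤ 1
  βν_le_one : ∀ t, I.β * I.ν t ≤ 1
  Θ_closed : IsClosed I.Θ
  Θ_convex : Convex ℝ I.Θ
  Ω_closed : IsClosed I.Ω
  Ω_convex : Convex ℝ I.Ω
  θ₀_mem : I.θ₀ ∈ I.Θ
  ω₀_mem : I.ω₀ ∈ I.Ω

/-- The state `((θ_t, ω_t), (p_t, d_t))` of the algorithm. -/
abbrev State (d : ℕ) := (Vec d × Vec d) × (Vec d × Vec d)

variable {𝒮 𝒜 : Type*} {d m n : ℕ}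

/-- The law of the state at time `0`. -/
def initLaw (I : Input d) (f : Objective 𝒮 𝒜 d) (S : Dataset 𝒮 𝒜 m n) : Measure (State d) :=
  overSample S fun ξ => (noisePair d (I.σsq 0)).map fun u =>
    ((I.θ₀, I.ω₀), (gradθ f I.θ₀ I.ω₀ ξ + u.1, gradω f I.θ₀ I.ω₀ ξ + u.2))

/-- `(θ_{t+1}, ω_{t+1})`, computed from the state at time `t`. -/
def nextIterate (I : Input d) (t : ℕ) (x : State d) : Vec d × Vec d :=
  (x.1.1 + I.ν t • (proj I.Θ (x.1.1 - I.κ • x.2.1) - x.1.1),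
   x.1.2 + I.ν t • (proj I.Ω (x.1.2 + I.η • x.2.2) - x.1.2))

/-- The conditional law of the state at time `t + 1`, given the state `x` at time `t`. -/
def stepLaw (I : Input d) (f : Objective 𝒮 𝒜 d) (S : Dataset 𝒮 𝒜 m n) (t : ℕ) (x : State d) :
    Measure (State d) :=
  overSample S fun ξ => (noisePair d (I.σsq (t + 1))).map fun u =>
    (nextIterate I t x,
      ((1 - I.α * I.ν t) • x.2.1
          + (I.α * I.ν t) • gradθ f (nextIterate I t x).1 (nextIterate I t x).2 ξ + u.1,
       (1 - I.β * I.ν t) • x.2.2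
          + (I.β * I.ν t) • gradω f (nextIterate I t x).1 (nextIterate I t x).2 ξ + u.2))

/-- The law of the state at time `t`. -/
def stateLaw (I : Input d) (f : Objective 𝒮 𝒜 d) (S : Dataset 𝒮 𝒜 m n) : ℕ → Measure (State d)
  | 0 => initLaw I f S
  | t + 1 => (stateLaw I f S t).bind (stepLaw I f S t)

/-- The law of the output: `(θ_t, ω_t)` for a uniformly random `t ∈ {0, …, T - 1}`. -/
def outputLaw (I : Input d) (f : Objective 𝒮 𝒜 d) (T : ℕ) (S : Dataset 𝒮 𝒜 m n) :
    Measure (Vec d × Vec d) :=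
  (T : ℝ≥0∞)⁻¹ • ∑ t ∈ Finset.range T, (stateLaw I f S t).map Prod.fst

end DPTD

end

noncomputable section

namespace DPTD

/-! Applied to one transition repeated `n` times, the averaged bound already bounds every single
gradient by `G`. In units of the noise, the shift caused by one transition therefore has squared
norm at most `1 / (2 n² σ'²)`, a factor `n²` smaller than the normalization of `σ'²` by `n G`
suggests.

A noisy gradient pair drawn from a dataset is a Gaussian mixture. Fix the transition used whenever
the exceptional trajectory is drawn, separately for each dataset. The two conditional densities are
then `Q` and `P = Q + q (D_b - D_c)` with `q = 1 / m`. Put `L = P / Q` and expand `L ^ α` to second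
order at `1`. The linear term integrates to zero and the remainder is of size `q²`. Since `Q ≥ q
D_c`, one has `L ≤ max 1 (D_b / D_c)`, and convexity bounds `1 / Q` by the average of `1 / D_a`. The
remainder thus becomes a combination of explicit Gaussian integrals, and
`lintegral_rpow_mixture_le_exp` gives a Rényi cost of `3.5 α / (m² σ'²)` per draw.

Costs add under adaptive composition (`RenyiClose.bind`), and the state at time `t < T` has used `t
+ 1 ≤ T` draws. The variance makes `T` draws cost `β' ε`. A Markov-type inequality
(`RenyiClose.apply_le`) turns this into `(ε, exp (-(α' - 1) (1 - β') ε))`-privacy of each iterate,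
and the choice of `α'` makes the second parameter `δ`. Choosing the output index at random is
harmless because the privacy inequality is linear in the laws. -/

/-- The density, with respect to the standard Gaussian measure, of its translate by `a`. -/
def gaussDensity {E : Type*} [NormedAddCommGroup E] [InnerProductSpace ℝ E] (a x : E) : ℝ :=
  Real.exp (inner ℝ a x - ‖a‖ ^ 2 / 2)

theorem gaussDensity_pos {E : Type*} [NormedAddCommGroup E] [InnerProductSpace ℝ E] (a x : E) :
    0 < gaussDensity a x := Real.exp_pos _

/-! ### Translates of Gaussian measures -/

theorem integrable_cexp_mul_gaussianReal (z : ℂ) :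
    Integrable (fun x : ℝ => Complex.exp (z * x)) (gaussianReal 0 1) := by
  have h : Integrable (fun x : ℝ => Real.exp (z.re * x)) (gaussianReal 0 1) :=
    integrable_exp_mul_gaussianReal z.re
  refine h.mono' (by fun_prop) (ae_of_all _ fun x => ?_)
  rw [Complex.norm_exp]
  simp

theorem integral_cexp_mul_gaussianReal (z : ℂ) :
    ∫ x : ℝ, Complex.exp (z * x) ∂(gaussianReal 0 1) = Complex.exp (z ^ 2 / 2) := by
  have h := complexMGF_id_gaussianReal (μ := 0) (v := 1) z
  simp only [complexMGF, id] at h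
  rw [h]
  simp

theorem integrable_cexp_sum_stdGaussian {d : ℕ} (z : Fin d → ℂ) :
    Integrable (fun x : Vec d => Complex.exp (∑ k, z k * x k)) (stdGaussian (Vec d)) := by
  rw [← map_pi_eq_stdGaussian, integrable_map_measure (by fun_prop) (by fun_prop)]
  have h := Integrable.fintype_prod (μ := fun _ : Fin d => gaussianReal 0 1)
    (fun k => integrable_cexp_mul_gaussianReal (z k))
  refine h.congr (ae_of_all _ fun x => ?_)
  simp [Complex.exp_sum]

/-- Complex coefficients let one formula serve both for exponential moments and for characteristic
functions of exponentially tilted Gaussians. -/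
theorem integral_cexp_sum_stdGaussian {d : ℕ} (z : Fin d → ℂ) :
    ∫ x : Vec d, Complex.exp (∑ k, z k * x k) ∂(stdGaussian (Vec d)) =
      Complex.exp (∑ k, z k ^ 2 / 2) := by
  rw [← map_pi_eq_stdGaussian, integral_map (by fun_prop) (by fun_prop)]
  have h := integral_fintype_prod_eq_prod (μ := fun _ : Fin d => gaussianReal 0 1)
    (fun k (x : ℝ) => Complex.exp (z k * x))
  simp only [integral_cexp_mul_gaussianReal] at h
  rw [Complex.exp_sum, ← h]
  simp [Complex.exp_sum]

theorem ofReal_exp_inner {d : ℕ} (a x : Vec d) :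
    ((Real.exp (inner ℝ a x) : ℝ) : ℂ) = Complex.exp (∑ k, (a k : ℂ) * x k) := by
  rw [PiLp.inner_apply]
  push_cast
  simp [mul_comm]

theorem integrable_exp_inner_stdGaussian {d : ℕ} (a : Vec d) :
    Integrable (fun x : Vec d => Real.exp (inner ℝ a x)) (stdGaussian (Vec d)) := by
  have h := (integrable_cexp_sum_stdGaussian fun k => (a k : ℂ)).re
  refine h.congr (ae_of_all _ fun x => ?_)
  simp only [← ofReal_exp_inner, RCLike.re_eq_complex_re, Complex.ofReal_re]

theorem integral_exp_inner_stdGaussian {d : ℕ} (a : Vec d) :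
    ∫ x : Vec d, Real.exp (inner ℝ a x) ∂(stdGaussian (Vec d)) = Real.exp (‖a‖ ^ 2 / 2) := by
  have h := integral_cexp_sum_stdGaussian fun k => (a k : ℂ)
  simp only [← ofReal_exp_inner] at h
  rw [integral_complex_ofReal] at h
  have h2 : Complex.exp (∑ k, (a k : ℂ) ^ 2 / 2) = ((Real.exp (‖a‖ ^ 2 / 2) : ℝ) : ℂ) := by
    rw [EuclideanSpace.norm_sq_eq, ← Finset.sum_div]
    push_cast
    simp [← Complex.ofReal_pow]
  rw [h2] at h
  exact_mod_cast h

/-- Cameron–Martin formula, by equality of characteristic functions: tilting by `a` replaces the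
coefficients `i t` by `a + i t` in the Gaussian exponential integral. -/
theorem map_add_stdGaussian {d : ℕ} (a : Vec d) :
    (stdGaussian (Vec d)).map (fun x => a + x) = (stdGaussian (Vec d)).withDensity
      fun x => ENNReal.ofReal (gaussDensity a x) := by
  unfold gaussDensity
  have hint : Integrable (fun x : Vec d => Real.exp (inner ℝ a x - ‖a‖ ^ 2 / 2))
      (stdGaussian (Vec d)) := by
    simp only [Real.exp_sub]
    exact (integrable_exp_inner_stdGaussian a).div_const _
  have : IsFiniteMeasure ((stdGaussian (Vec d)).withDensity
      fun x => ENNReal.ofReal (Real.exp (inner ℝ a x - ‖a‖ ^ 2 / 2))) :=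
    isFiniteMeasure_withDensity_ofReal hint.2
  have : IsFiniteMeasure ((stdGaussian (Vec d)).map (fun x => a + x)) :=
    Measure.isFiniteMeasure_map _ _
  refine Measure.ext_of_charFun (funext fun t => ?_)
  rw [charFun_apply, charFun_apply, integral_map (by fun_prop) (by fun_prop),
    integral_withDensity_eq_integral_toReal_smul (by fun_prop) (by simp)]
  have h1 : ∀ x : Vec d, Complex.exp (inner ℝ (a + x) t * Complex.I) =
      Complex.exp (inner ℝ a t * Complex.I) *
        Complex.exp (∑ k, (t k * Complex.I : ℂ) * x k) := fun x => by
    rw [← Complex.exp_add, inner_add_left, PiLp.inner_apply x]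
    congr 1
    push_cast
    rw [add_mul, Finset.sum_mul]
    congr 1
    refine Finset.sum_congr rfl fun k _ => ?_
    simp
    ring
  have h2 : ∀ x : Vec d, (ENNReal.ofReal (Real.exp (inner ℝ a x - ‖a‖ ^ 2 / 2))).toReal •
      Complex.exp (inner ℝ x t * Complex.I) = Complex.exp (-(‖a‖ ^ 2 / 2 : ℝ)) *
        Complex.exp (∑ k, (a k + t k * Complex.I : ℂ) * x k) := fun x => by
    rw [ENNReal.toReal_ofReal (Real.exp_nonneg _), Complex.real_smul, Complex.ofReal_exp,
      ← Complex.exp_add, ← Complex.exp_add, PiLp.inner_apply a, PiLp.inner_apply x]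
    congr 1
    push_cast
    simp only [add_mul, Finset.sum_add_distrib, Finset.sum_mul]
    have e1 : ∑ k, ((inner ℝ (a k) (x k) : ℝ) : ℂ) = ∑ k, (a k : ℂ) * x k := by
      refine Finset.sum_congr rfl fun k _ => ?_
      simp [mul_comm]
    have e2 : ∑ k, ((inner ℝ (x k) (t k) : ℝ) : ℂ) * Complex.I
        = ∑ k, (t k : ℂ) * Complex.I * x k := by
      refine Finset.sum_congr rfl fun k _ => ?_
      simp
      ring
    rw [e1, e2]
    ring
  simp only [h1, h2]
  rw [integral_const_mul, integral_const_mul, integral_cexp_sum_stdGaussian,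
    integral_cexp_sum_stdGaussian, ← Complex.exp_add, ← Complex.exp_add]
  congr 1
  rw [EuclideanSpace.norm_sq_eq, PiLp.inner_apply]
  push_cast
  rw [Finset.sum_mul, Finset.sum_div, ← Finset.sum_neg_distrib, ← Finset.sum_add_distrib,
    ← Finset.sum_add_distrib]
  refine Finset.sum_congr rfl fun k _ => ?_
  have : ((‖a k‖ : ℂ)) ^ 2 = (a k : ℂ) ^ 2 := by
    rw [← Complex.ofReal_pow, ← Complex.ofReal_pow]; simp
  rw [this]
  simp
  ring

/-- The law of two independent standard Gaussian vectors. -/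
def stdPair (d : ℕ) : Measure (Vec d × Vec d) :=
  (stdGaussian (Vec d)).prod (stdGaussian (Vec d))

instance (d : ℕ) : IsProbabilityMeasure (stdPair d) := by
  unfold stdPair; infer_instance

/-- `Vec d × Vec d` carries the sup norm, while the Gaussian exponent needs the Euclidean one; hence
the passage through `WithLp 2`. -/
theorem inner_toLp_prod {d : ℕ} (v : WithLp 2 (Vec d × Vec d)) (x : Vec d × Vec d) :
    inner ℝ v (WithLp.toLp 2 x) = inner ℝ v.fst x.1 + inner ℝ v.snd x.2 := by
  rw [WithLp.prod_inner_apply]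
  rfl

theorem integrable_exp_inner_stdPair {d : ℕ} (v : WithLp 2 (Vec d × Vec d)) :
    Integrable (fun x => Real.exp (inner ℝ v (WithLp.toLp 2 x))) (stdPair d) := by
  simp only [inner_toLp_prod, Real.exp_add]
  exact (integrable_exp_inner_stdGaussian v.fst).mul_prod (integrable_exp_inner_stdGaussian v.snd)

theorem integral_exp_inner_stdPair {d : ℕ} (v : WithLp 2 (Vec d × Vec d)) :
    ∫ x, Real.exp (inner ℝ v (WithLp.toLp 2 x)) ∂(stdPair d) = Real.exp (‖v‖ ^ 2 / 2) := by
  simp only [inner_toLp_prod, Real.exp_add]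
  rw [stdPair, integral_prod_mul (fun x => Real.exp (inner ℝ v.fst x))
    (fun x => Real.exp (inner ℝ v.snd x)), integral_exp_inner_stdGaussian,
    integral_exp_inner_stdGaussian, ← Real.exp_add, WithLp.prod_norm_sq_eq_of_L2, add_div]

theorem map_add_stdPair {d : ℕ} (a : Vec d × Vec d) :
    (stdPair d).map (fun x => a + x) = (stdPair d).withDensity
      fun x => ENNReal.ofReal (gaussDensity (WithLp.toLp 2 a) (WithLp.toLp 2 x)) := by
  have h := Measure.map_prod_map (stdGaussian (Vec d)) (stdGaussian (Vec d))
    (f := fun x => a.1 + x) (g := fun x => a.2 + x) (by fun_prop) (by fun_prop)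
  have hm : ∀ b : Vec d, Measurable fun x : Vec d => ENNReal.ofReal (gaussDensity b x) := by
    intro b; unfold gaussDensity; fun_prop
  rw [map_add_stdGaussian, map_add_stdGaussian, prod_withDensity (hm _) (hm _)] at h
  refine h.symm.trans ?_
  rw [stdPair]
  congr 1
  funext x
  rw [← ENNReal.ofReal_mul (gaussDensity_pos _ _).le, gaussDensity, gaussDensity, gaussDensity,
    ← Real.exp_add, inner_toLp_prod, WithLp.prod_norm_sq_eq_of_L2]
  congr 2
  simp only [WithLp.toLp_fst, WithLp.toLp_snd]
  ring

theorem noisePair_eq_map_stdPair (d : ℕ) (v : ℝ) :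
    noisePair d v = (stdPair d).map fun x => Real.sqrt v • x := by
  rw [noisePair, gaussianNoise, Measure.map_prod_map _ _ (by fun_prop) (by fun_prop)]
  rfl

/-- The scale goes into the outer map, so every noisy gradient has a density with respect to the
same reference measure `stdPair d`, depending only on the shift in units of the noise. -/
theorem map_add_noisePair {d : ℕ} {v : ℝ} (hv : 0 < v) (g : Vec d × Vec d) :
    (noisePair d v).map (fun u => g + u) = ((stdPair d).withDensity fun x => ENNReal.ofReal
      (gaussDensity (WithLp.toLp 2 ((Real.sqrt v)⁻¹ • g)) (WithLp.toLp 2 x))).map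
        fun x => Real.sqrt v • x := by
  rw [← map_add_stdPair, noisePair_eq_map_stdPair, Measure.map_map (by fun_prop) (by fun_prop),
    Measure.map_map (by fun_prop) (by fun_prop)]
  congr 1
  funext x
  simp [smul_smul, (Real.sqrt_pos.2 hv).ne']

/-! ### Second order bounds for real powers -/

/-- The right side equals `(2 - α) x + (α - 1) x²`, so this is weighted AM-GM for `x ^ α = x ^ (2 -
α) * (x²) ^ (α - 1)`. -/
theorem rpow_le_of_le_two {α x : ℝ} (h1 : 1 ≤ α) (h2 : α ≤ 2) (hx : 0 < x) :
    x ^ α ≤ 1 + α * (x - 1) + (α - 1) * (x - 1) ^ 2 := by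
  have h := Real.geom_mean_le_arith_mean2_weighted (w₁ := 2 - α) (w₂ := α - 1) (p₁ := x)
    (p₂ := x ^ 2) (by linarith) (by linarith) hx.le (by positivity) (by ring)
  rw [← Real.rpow_natCast x 2, ← Real.rpow_mul hx.le, ← Real.rpow_add hx] at h
  have e : 2 - α + ((2 : ℕ) : ℝ) * (α - 1) = α := by push_cast; ring
  rw [e, Real.rpow_natCast] at h
  nlinarith

theorem one_add_mul_le_rpow {α x : ℝ} (h1 : 1 ≤ α) (hx : 0 < x) : 1 + α * (x - 1) ≤ x ^ α := by
  have h := one_add_mul_self_le_rpow_one_add (s := x - 1) (by linarith) h1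
  simpa using h

/-- Bernoulli's inequality at `x⁻¹`, multiplied by `x ^ α`. -/
theorem rpow_sub_one_le {α x : ℝ} (h1 : 1 ≤ α) (hx : 0 < x) :
    x ^ α - 1 ≤ α * x ^ (α - 1) * (x - 1) := by
  have h := one_add_mul_le_rpow h1 (inv_pos.2 hx)
  rw [Real.inv_rpow hx.le] at h
  have hp : 0 < x ^ α := Real.rpow_pos_of_pos hx α
  have h3 := mul_le_mul_of_nonneg_left h hp.le
  rw [mul_inv_cancel₀ hp.ne'] at h3
  rw [Real.rpow_sub_one hx.ne']
  have e : x ^ α * (1 + α * (x⁻¹ - 1)) = x ^ α - α * (x ^ α / x) * (x - 1) := by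
    field_simp
    ring
  rw [e] at h3
  linarith

/-- The preceding bound, with `x ^ (α - 1)` written as `1 + (x ^ (α - 1) - 1)`, leaves a product
treated by the same convexity at exponent `α - 1`. In the application `x` is a mixture ratio and `y`
the ratio `D_b / D_c` of two single Gaussians, whose powers integrate in closed form. -/
theorem rpow_le_of_two_le {α x y : ℝ} (h2 : 2 ≤ α) (hx : 0 < x) (hy : 0 < y) (hxy : x ≤ max 1 y) :
    x ^ α ≤ 1 + α * (x - 1) + α * (α - 1) * (x - 1) ^ 2 * (1 + y ^ (α - 2)) := by
  have h := rpow_sub_one_le (by linarith : 1 ≤ α) hx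
  have hy' : 0 < y ^ (α - 2) := Real.rpow_pos_of_pos hy _
  have key : (x - 1) * (x ^ (α - 1) - 1) ≤ (α - 1) * (x - 1) ^ 2 * (1 + y ^ (α - 2)) := by
    have hc : 0 ≤ (α - 1) * (x - 1) ^ 2 := mul_nonneg (by linarith) (sq_nonneg _)
    rcases le_total 1 x with hx1 | hx1
    · have h3 := rpow_sub_one_le (by linarith : 1 ≤ α - 1) hx
      have e : α - 1 - 1 = α - 2 := by ring
      rw [e] at h3
      have h4 : x ^ (α - 2) ≤ 1 + y ^ (α - 2) := by
        rcases le_max_iff.1 hxy with h5 | h5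
        · have := Real.rpow_le_one hx.le h5 (by linarith : 0 ≤ α - 2)
          linarith
        · have := Real.rpow_le_rpow hx.le h5 (by linarith : 0 ≤ α - 2)
          linarith
      calc (x - 1) * (x ^ (α - 1) - 1)
          ≤ (x - 1) * ((α - 1) * x ^ (α - 2) * (x - 1)) :=
            mul_le_mul_of_nonneg_left h3 (by linarith)
        _ = (α - 1) * (x - 1) ^ 2 * x ^ (α - 2) := by ring
        _ ≤ _ := mul_le_mul_of_nonneg_left h4 hc
    · have h3 := one_add_mul_le_rpow (by linarith : 1 ≤ α - 1) hx
      calc (x - 1) * (x ^ (α - 1) - 1) ≤ (α - 1) * (x - 1) ^ 2 * 1 := by nlinarith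
        _ ≤ _ := mul_le_mul_of_nonneg_left (by linarith) hc
  nlinarith

/-! ### Moments of ratios of Gaussian mixtures -/

section GaussianMixtures

variable {Ω E : Type*} [MeasurableSpace Ω] [NormedAddCommGroup E] [InnerProductSpace ℝ E]

/-- The moment generating function of `ψ` under `μ` is that of a standard Gaussian vector. -/
structure HasStdGaussianMGF (ψ : Ω → E) (μ : Measure Ω) : Prop where
  integrable (v : E) : Integrable (fun x => Real.exp (inner ℝ v (ψ x))) μ
  integral (v : E) : ∫ x, Real.exp (inner ℝ v (ψ x)) ∂μ = Real.exp (‖v‖ ^ 2 / 2)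

theorem HasStdGaussianMGF.integrable_gaussDensity {ψ : Ω → E} {μ : Measure Ω}
    (h : HasStdGaussianMGF ψ μ) (a : E) : Integrable (fun x => gaussDensity a (ψ x)) μ := by
  simp only [gaussDensity, Real.exp_sub]
  exact (h.integrable a).div_const _

theorem HasStdGaussianMGF.integral_gaussDensity {ψ : Ω → E} {μ : Measure Ω}
    (h : HasStdGaussianMGF ψ μ) (a : E) : ∫ x, gaussDensity a (ψ x) ∂μ = 1 := by
  simp only [gaussDensity, Real.exp_sub]
  rw [integral_div, h.integral, div_self (Real.exp_ne_zero _)]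

/-- The logarithm of `∫ D_b ^ j * D_c ^ (2 - j) / D_a` for the Gaussian densities `D_a, D_b, D_c`. -/
def logMoment (a b c : E) (j : ℝ) : ℝ :=
  (j ^ 2 - j) / 2 * ‖b - c‖ ^ 2 + j * inner ℝ (b - c) (c - a) + ‖c - a‖ ^ 2

/-- Completing the square: a monomial in Gaussian densities is a constant times another such
density, so its integral is that constant. -/
theorem gaussDensity_monomial (a b c x : E) (j : ℝ) :
    gaussDensity c x ^ 2 * (gaussDensity b x / gaussDensity c x) ^ j / gaussDensity a x =
      Real.exp (logMoment a b c j) * gaussDensity (j • b + (2 - j) • c - a) x := by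
  simp only [gaussDensity]
  rw [← Real.exp_sub, ← Real.exp_mul, ← Real.exp_nat_mul, ← Real.exp_add, ← Real.exp_sub,
    ← Real.exp_add]
  congr 1
  simp only [logMoment, ← real_inner_self_eq_norm_sq, inner_add_left, inner_sub_left,
    inner_sub_right, inner_add_right, real_inner_smul_left, real_inner_smul_right]
  rw [real_inner_comm b a, real_inner_comm c a, real_inner_comm c b]
  push_cast
  ring

/-- The integrand `(D_b - D_c) ^ 2 * (D_b / D_c) ^ k / D_a`. -/
def chiIntegrand (a b c : E) (k : ℝ) (x : E) : ℝ :=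
  (gaussDensity b x - gaussDensity c x) ^ 2 * (gaussDensity b x / gaussDensity c x) ^ k /
    gaussDensity a x

theorem chiIntegrand_eq (a b c : E) (k : ℝ) (x : E) :
    chiIntegrand a b c k x =
      Real.exp (logMoment a b c (k + 2)) * gaussDensity ((k + 2) • b + (2 - (k + 2)) • c - a) x
      - 2 * (Real.exp (logMoment a b c (k + 1)) *
          gaussDensity ((k + 1) • b + (2 - (k + 1)) • c - a) x)
      + Real.exp (logMoment a b c k) * gaussDensity (k • b + (2 - k) • c - a) x := by
  simp only [← gaussDensity_monomial, chiIntegrand]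
  have hb := gaussDensity_pos b x
  have hc := gaussDensity_pos c x
  have ha := gaussDensity_pos a x
  have hr : 0 < gaussDensity b x / gaussDensity c x := div_pos hb hc
  rw [Real.rpow_add hr, Real.rpow_add hr, Real.rpow_one, Real.rpow_two]
  field_simp
  ring

variable {ψ : Ω → E} {μ : Measure Ω}

theorem HasStdGaussianMGF.integrable_chiIntegrand (h : HasStdGaussianMGF ψ μ) (a b c : E) (k : ℝ) :
    Integrable (fun x => chiIntegrand a b c k (ψ x)) μ := by
  simp only [chiIntegrand_eq]
  exact (((h.integrable_gaussDensity _).const_mul _).sub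
    (((h.integrable_gaussDensity _).const_mul _).const_mul _)).add
    ((h.integrable_gaussDensity _).const_mul _)

theorem HasStdGaussianMGF.integral_chiIntegrand (h : HasStdGaussianMGF ψ μ) (a b c : E) (k : ℝ) :
    ∫ x, chiIntegrand a b c k (ψ x) ∂μ = Real.exp (logMoment a b c (k + 2))
      - 2 * Real.exp (logMoment a b c (k + 1)) + Real.exp (logMoment a b c k) := by
  simp only [chiIntegrand_eq]
  rw [integral_add, integral_sub]
  · simp only [integral_const_mul, h.integral_gaussDensity, mul_one]
  · exact (h.integrable_gaussDensity _).const_mul _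
  · exact ((h.integrable_gaussDensity _).const_mul _).const_mul _
  · exact ((h.integrable_gaussDensity _).const_mul _).sub
      (((h.integrable_gaussDensity _).const_mul _).const_mul _)
  · exact (h.integrable_gaussDensity _).const_mul _

theorem norm_sub_sq_le_of_sq_le {s : ℝ} {a b : E} (ha : 4 * ‖a‖ ^ 2 ≤ s) (hb : 4 * ‖b‖ ^ 2 ≤ s) :
    ‖a - b‖ ^ 2 ≤ s := by
  have := parallelogram_law_with_norm ℝ a b
  nlinarith [sq_nonneg ‖a + b‖]

theorem abs_inner_le_of_sq_le {s : ℝ} {a b : E} (ha : ‖a‖ ^ 2 ≤ s) (hb : ‖b‖ ^ 2 ≤ s) :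
    |inner ℝ a b| ≤ s := by
  refine (abs_real_inner_le_norm a b).trans ?_
  nlinarith [sq_nonneg (‖a‖ - ‖b‖)]

/-- Here the exponents are `‖b - a‖²`, `⟪b - a, c - a⟫` and `‖c - a‖²`, all of size at most `s`. The
outer exponentials are at most `1 + 2.5 s` and the middle one is at least `1 - s`, which gives `5 s
+ 2 s`. -/
theorem chi_sq_le {s : ℝ} {a b c : E} (ha : 4 * ‖a‖ ^ 2 ≤ s) (hb : 4 * ‖b‖ ^ 2 ≤ s)
    (hc : 4 * ‖c‖ ^ 2 ≤ s) (hs : s ≤ 0.715) :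
    Real.exp (logMoment a b c (0 + 2)) - 2 * Real.exp (logMoment a b c (0 + 1))
      + Real.exp (logMoment a b c 0) ≤ 7 * s := by
  have e2 : logMoment a b c (0 + 2) = ‖b - a‖ ^ 2 := by
    have : b - a = (b - c) + (c - a) := by abel
    rw [this, norm_add_sq_real, logMoment]
    ring
  have e1 : logMoment a b c (0 + 1) = inner ℝ (b - a) (c - a) := by
    have : b - a = (b - c) + (c - a) := by abel
    rw [this, inner_add_left, real_inner_self_eq_norm_sq, logMoment]
    ring
  have e0 : logMoment a b c 0 = ‖c - a‖ ^ 2 := by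
    rw [logMoment]
    ring
  have hexp : ∀ x, 0 ≤ x → x ≤ s → Real.exp x ≤ 1 + 2.5 * s := by
    intro x hx0 hxs
    have h1 := Real.add_one_le_exp (-x)
    have h2 := Real.add_one_le_exp (-x / 2)
    have h3 : Real.exp (-x / 2) * Real.exp (-x / 2) = Real.exp (-x) := by
      rw [← Real.exp_add]; congr 1; ring
    have h4 : Real.exp (-x) * Real.exp x = 1 := by rw [← Real.exp_add]; simp
    -- `exp (-x) ≥ (1 - x / 2)²`, and `(1 - 0.715 / 2)² > 0.4`.
    have h5 : 0.4 ≤ Real.exp (-x) := by nlinarith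
    have h6 := Real.exp_pos x
    have h7 : Real.exp x ≤ 2.5 := by nlinarith
    nlinarith
  have hba := norm_sub_sq_le_of_sq_le hb ha
  have hca := norm_sub_sq_le_of_sq_le hc ha
  have h1 := abs_le.1 (abs_inner_le_of_sq_le hba hca)
  rw [e0, e1, e2]
  have := hexp _ (sq_nonneg _) hba
  have := hexp _ (sq_nonneg _) hca
  have := Real.add_one_le_exp (inner ℝ (b - a) (c - a))
  linarith

/-- With the middle exponential factored out, what remains is `exp h + exp h' - 2`. The linear terms
nearly cancel, `h + h' = ‖b - c‖² ≤ s`, and the errors `h²`, `h'²` are each at most `((k + 2) s)² ≤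
s` because `α² s ≤ 1`. The remaining factor is thus at most `3 s`, and the middle exponential is at
most `e < 3`. -/
theorem chi_weighted_le {s k α : ℝ} {a b c : E} (ha : 4 * ‖a‖ ^ 2 ≤ s) (hb : 4 * ‖b‖ ^ 2 ≤ s)
    (hc : 4 * ‖c‖ ^ 2 ≤ s) (hk : 0 ≤ k) (hkα : k + 2 ≤ α) (hαs : α ^ 2 * s ≤ 1) :
    Real.exp (logMoment a b c (k + 2)) - 2 * Real.exp (logMoment a b c (k + 1))
      + Real.exp (logMoment a b c k) ≤ 9 * s := by
  have hd := norm_sub_sq_le_of_sq_le hb hc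
  have he := norm_sub_sq_le_of_sq_le hc ha
  have hi := abs_le.1 (abs_inner_le_of_sq_le hd he)
  have hd0 := sq_nonneg ‖b - c‖
  have hs0 : 0 ≤ s := hd0.trans hd
  set D := ‖b - c‖ ^ 2
  set i : ℝ := inner ℝ (b - c) (c - a)
  set h := (k + 1) * D + i
  set h' := -(k * D + i)
  have e2 : logMoment a b c (k + 2) = logMoment a b c (k + 1) + h := by
    simp only [logMoment, h]; ring
  have e0 : logMoment a b c k = logMoment a b c (k + 1) + h' := by
    simp only [logMoment, h']; ring
  have hks : (k + 2) ^ 2 * s ≤ 1 := le_trans (by gcongr) hαs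
  have hkD : k * D ≤ k * s := by gcongr
  have hkD0 : 0 ≤ k * D := by positivity
  have hh : |h| ≤ (k + 2) * s := abs_le.2 ⟨by simp only [h]; nlinarith, by simp only [h]; nlinarith⟩
  have hh' : |h'| ≤ (k + 2) * s :=
    abs_le.2 ⟨by simp only [h']; nlinarith, by simp only [h']; nlinarith⟩
  have hsq : ((k + 2) * s) ^ 2 ≤ s := by nlinarith
  have hone : (k + 2) * s ≤ 1 := by nlinarith [mul_nonneg hk hs0]
  have b1 := (abs_le.1 (Real.abs_exp_sub_one_sub_id_le (hh.trans hone))).2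
  have b2 := (abs_le.1 (Real.abs_exp_sub_one_sub_id_le (hh'.trans hone))).2
  have q1 : h ^ 2 ≤ s := (sq_le_sq' (abs_le.1 hh).1 (abs_le.1 hh).2).trans hsq
  have q2 : h' ^ 2 ≤ s := (sq_le_sq' (abs_le.1 hh').1 (abs_le.1 hh').2).trans hsq
  have hsum : h + h' = D := by simp only [h, h']; ring
  have hg : logMoment a b c (k + 1) ≤ 1 := by
    have : ((k + 1) ^ 2 - (k + 1)) / 2 * D ≤ ((k + 1) ^ 2 - (k + 1)) / 2 * s := by
      have : 0 ≤ ((k + 1) ^ 2 - (k + 1)) / 2 := by nlinarith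
      gcongr
    have : (k + 1) * i ≤ (k + 1) * s := by gcongr; exact hi.2
    simp only [logMoment]
    nlinarith [mul_nonneg hk hs0]
  have hge : Real.exp (logMoment a b c (k + 1)) ≤ 3 :=
    (Real.exp_le_exp.2 hg).trans (Real.exp_one_lt_d9.le.trans (by norm_num))
  rw [e2, e0, Real.exp_add _ h, Real.exp_add _ h']
  calc _ = Real.exp (logMoment a b c (k + 1)) * (Real.exp h + Real.exp h' - 2) := by ring
    _ ≤ Real.exp (logMoment a b c (k + 1)) * (3 * s) := by
        gcongr
        linarith
    _ ≤ 3 * (3 * s) := by gcongr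
    _ = 9 * s := by ring

theorem inv_sum_le {ι : Type*} (t : Finset ι) (w x : ι → ℝ) (hw : ∀ i ∈ t, 0 ≤ w i)
    (hw1 : ∑ i ∈ t, w i = 1) (hx : ∀ i ∈ t, 0 < x i) :
    (∑ i ∈ t, w i * x i)⁻¹ ≤ ∑ i ∈ t, w i * (x i)⁻¹ := by
  have h := (convexOn_zpow (-1)).map_sum_le (t := t) (w := w) (p := x) hw hw1 hx
  simpa using h

/-- The hypothesis `hpow` abstracts the second order bound for `x ^ α`, so that the ranges `α ≤ 2`
and `α ≥ 2` share one argument. `U` is the resulting integrable majorant. -/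
theorem HasStdGaussianMGF.lintegral_rpow_mixture_le (hψ : HasStdGaussianMGF ψ μ)
    {ι : Type*} [Fintype ι] {w : ι → ℝ} {a : ι → E} {b c : E} {q α K k X C₁ : ℝ}
    (hw : ∀ i, 0 ≤ w i) (hw1 : ∑ i, w i = 1) (hq : 0 < q)
    (hQ : ∀ x, q * gaussDensity c x ≤ ∑ i, w i * gaussDensity (a i) x)
    (hK : 0 ≤ K) (hC₁ : 0 ≤ C₁)
    (hpow : ∀ x y : ℝ, 0 < x → 0 < y → x ≤ max 1 y →
      x ^ α ≤ 1 + α * (x - 1) + K * (x - 1) ^ 2 * (1 + C₁ * y ^ k))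
    (h0 : ∀ i, Real.exp (logMoment (a i) b c (0 + 2)) - 2 * Real.exp (logMoment (a i) b c (0 + 1))
      + Real.exp (logMoment (a i) b c 0) ≤ X)
    (hk : ∀ i, Real.exp (logMoment (a i) b c (k + 2)) - 2 * Real.exp (logMoment (a i) b c (k + 1))
      + Real.exp (logMoment (a i) b c k) ≤ X) :
    ∫⁻ x, ENNReal.ofReal (((∑ i, w i * gaussDensity (a i) (ψ x)) +
        q * (gaussDensity b (ψ x) - gaussDensity c (ψ x))) ^ α *
        (∑ i, w i * gaussDensity (a i) (ψ x)) ^ (1 - α)) ∂μ ≤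
      ENNReal.ofReal (1 + K * q ^ 2 * (1 + C₁) * X) := by
  set U : Ω → ℝ := fun x => ((∑ i, w i * gaussDensity (a i) (ψ x)) +
      α * q * (gaussDensity b (ψ x) - gaussDensity c (ψ x))) +
      K * q ^ 2 * ∑ i, w i * (chiIntegrand (a i) b c 0 (ψ x) +
        C₁ * chiIntegrand (a i) b c k (ψ x)) with hU
  have hUpos : ∀ x, ((∑ i, w i * gaussDensity (a i) (ψ x)) +
        q * (gaussDensity b (ψ x) - gaussDensity c (ψ x))) ^ α *
        (∑ i, w i * gaussDensity (a i) (ψ x)) ^ (1 - α) ≤ U x ∧ 0 ≤ U x := by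
    intro x
    set y := ψ x
    have hb := gaussDensity_pos b y
    have hc := gaussDensity_pos c y
    have hQx := hQ y
    have hinv := inv_sum_le Finset.univ w (fun i => gaussDensity (a i) y) (fun i _ => hw i) hw1
      (fun i _ => gaussDensity_pos _ _)
    set Q := ∑ i, w i * gaussDensity (a i) y with hQdef
    set B := gaussDensity b y
    set C := gaussDensity c y
    have hQ0 : 0 < Q := lt_of_lt_of_le (mul_pos hq hc) hQx
    have hP0 : 0 < Q + q * (B - C) := by nlinarith [mul_pos hq hb]
    have hL0 : 0 < (Q + q * (B - C)) / Q := div_pos hP0 hQ0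
    -- If `B ≥ C`, then `Q ≥ q C` gives `1 + q (B - C) / Q ≤ 1 + (B - C) / C = B / C`; otherwise the
    -- ratio is at most `1`.
    have hLmax : (Q + q * (B - C)) / Q ≤ max 1 (B / C) := by
      rw [div_le_iff₀ hQ0]
      rcases le_total B C with hBC | hBC
      · have := le_max_left 1 (B / C)
        nlinarith
      · have h1 := le_max_right 1 (B / C)
        refine le_trans ?_ (mul_le_mul_of_nonneg_right h1 hQ0.le)
        rw [div_mul_eq_mul_div, le_div_iff₀ hc]
        nlinarith
    have hp := hpow _ _ hL0 (div_pos hb hc) hLmax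
    have e : (Q + q * (B - C)) ^ α * Q ^ (1 - α) = Q * ((Q + q * (B - C)) / Q) ^ α := by
      rw [Real.div_rpow hP0.le hQ0.le, Real.rpow_sub hQ0, Real.rpow_one]
      ring
    have hle : Q * ((Q + q * (B - C)) / Q) ^ α ≤ U x := by
      calc Q * ((Q + q * (B - C)) / Q) ^ α
          ≤ Q * (1 + α * ((Q + q * (B - C)) / Q - 1) + K * ((Q + q * (B - C)) / Q - 1) ^ 2 *
            (1 + C₁ * (B / C) ^ k)) := mul_le_mul_of_nonneg_left hp hQ0.le
        _ = Q + α * q * (B - C) +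
            K * q ^ 2 * ((B - C) ^ 2 * (1 + C₁ * (B / C) ^ k) * Q⁻¹) := by
            field_simp
            ring
        _ ≤ Q + α * q * (B - C) + K * q ^ 2 * ((B - C) ^ 2 * (1 + C₁ * (B / C) ^ k) *
              ∑ i, w i * (gaussDensity (a i) y)⁻¹) := by
            have : 0 < (B / C) ^ k := Real.rpow_pos_of_pos (div_pos hb hc) _
            gcongr
        _ = U x := by
            simp only [hU]
            congr 2
            rw [Finset.mul_sum]
            refine Finset.sum_congr rfl fun i _ => ?_
            simp only [chiIntegrand, Real.rpow_zero]
            ring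
    rw [e]
    exact ⟨hle, le_trans (by positivity) hle⟩
  have i1 : Integrable (fun x => ∑ i, w i * gaussDensity (a i) (ψ x)) μ :=
    integrable_finsetSum _ fun i _ => (hψ.integrable_gaussDensity _).const_mul _
  have i2 : Integrable (fun x => α * q * (gaussDensity b (ψ x) - gaussDensity c (ψ x))) μ :=
    ((hψ.integrable_gaussDensity _).sub (hψ.integrable_gaussDensity _)).const_mul _
  have i12 : Integrable (fun x => (∑ i, w i * gaussDensity (a i) (ψ x)) +
      α * q * (gaussDensity b (ψ x) - gaussDensity c (ψ x))) μ := i1.add i2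
  have i3 : ∀ i, Integrable (fun x => w i * (chiIntegrand (a i) b c 0 (ψ x) +
        C₁ * chiIntegrand (a i) b c k (ψ x))) μ := fun i =>
    ((hψ.integrable_chiIntegrand _ _ _ _).add
      ((hψ.integrable_chiIntegrand _ _ _ _).const_mul _)).const_mul _
  have i4 : Integrable (fun x => K * q ^ 2 * ∑ i, w i * (chiIntegrand (a i) b c 0 (ψ x) +
        C₁ * chiIntegrand (a i) b c k (ψ x))) μ :=
    (integrable_finsetSum _ fun i _ => i3 i).const_mul _
  have hUint : Integrable U μ := i12.add i4
  have hUval : ∫ x, U x ∂μ ≤ 1 + K * q ^ 2 * (1 + C₁) * X := by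
    have e : ∫ x, U x ∂μ = 1 + K * q ^ 2 * ∑ i, w i * (
        (Real.exp (logMoment (a i) b c (0 + 2)) - 2 * Real.exp (logMoment (a i) b c (0 + 1))
          + Real.exp (logMoment (a i) b c 0)) +
        C₁ * (Real.exp (logMoment (a i) b c (k + 2)) - 2 * Real.exp (logMoment (a i) b c (k + 1))
          + Real.exp (logMoment (a i) b c k))) := by
      simp only [hU]
      rw [integral_add i12 i4, integral_add i1 i2, integral_finsetSum _
        (fun i _ => (hψ.integrable_gaussDensity _).const_mul _), integral_const_mul,
        integral_const_mul, integral_finsetSum _ (fun i _ => i3 i),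
        -- The first order term vanishes because `D_b` and `D_c` both have mass one.
        integral_sub (hψ.integrable_gaussDensity _) (hψ.integrable_gaussDensity _)]
      simp only [integral_const_mul, hψ.integral_gaussDensity, mul_one, hw1, sub_self, mul_zero,
        add_zero]
      congr 2
      refine Finset.sum_congr rfl fun i _ => ?_
      rw [integral_add (hψ.integrable_chiIntegrand _ _ _ _)
        ((hψ.integrable_chiIntegrand _ _ _ _).const_mul _), integral_const_mul,
        hψ.integral_chiIntegrand, hψ.integral_chiIntegrand]
    rw [e]
    have hs : ∑ i, w i * (
        (Real.exp (logMoment (a i) b c (0 + 2)) - 2 * Real.exp (logMoment (a i) b c (0 + 1))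
          + Real.exp (logMoment (a i) b c 0)) +
        C₁ * (Real.exp (logMoment (a i) b c (k + 2)) - 2 * Real.exp (logMoment (a i) b c (k + 1))
          + Real.exp (logMoment (a i) b c k))) ≤ ∑ i, w i * ((1 + C₁) * X) := by
      refine Finset.sum_le_sum fun i _ => mul_le_mul_of_nonneg_left ?_ (hw i)
      have := mul_le_mul_of_nonneg_left (hk i) hC₁
      linarith [h0 i]
    rw [← Finset.sum_mul, hw1, one_mul] at hs
    have := mul_le_mul_of_nonneg_left hs (by positivity : 0 ≤ K * q ^ 2)
    linarith
  calc _ ≤ ∫⁻ x, ENNReal.ofReal (U x) ∂μ :=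
        lintegral_mono fun x => ENNReal.ofReal_le_ofReal (hUpos x).1
    _ = ENNReal.ofReal (∫ x, U x ∂μ) :=
        (ofReal_integral_eq_lintegral_ofReal hUint (ae_of_all _ fun x => (hUpos x).2)).symm
    _ ≤ _ := ENNReal.ofReal_le_ofReal hUval

theorem HasStdGaussianMGF.lintegral_rpow_mixture_le_exp (hψ : HasStdGaussianMGF ψ μ)
    {ι : Type*} [Fintype ι] {w : ι → ℝ} {a : ι → E} {b c : E} {q α τ : ℝ} {n : ℕ}
    (hw : ∀ i, 0 ≤ w i) (hw1 : ∑ i, w i = 1) (hq : 0 < q)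
    (hQ : ∀ x, q * gaussDensity c x ≤ ∑ i, w i * gaussDensity (a i) x)
    (hα : 1 < α) (hτ : 0.7 ≤ τ) (hn : α * (1 + τ) ≤ n)
    (ha : ∀ i, ‖a i‖ ^ 2 ≤ 1 / (2 * n ^ 2 * τ)) (hb : ‖b‖ ^ 2 ≤ 1 / (2 * n ^ 2 * τ))
    (hc : ‖c‖ ^ 2 ≤ 1 / (2 * n ^ 2 * τ)) :
    ∫⁻ x, ENNReal.ofReal (((∑ i, w i * gaussDensity (a i) (ψ x)) +
        q * (gaussDensity b (ψ x) - gaussDensity c (ψ x))) ^ α *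
        (∑ i, w i * gaussDensity (a i) (ψ x)) ^ (1 - α)) ∂μ ≤
      ENNReal.ofReal (Real.exp ((α - 1) * (3.5 * α * q ^ 2 / τ))) := by
  have hτ0 : 0 < τ := by linarith
  have hn2 : (2 : ℝ) ≤ n := by
    have : (1 : ℝ) < n := by nlinarith
    have : 1 < n := by exact_mod_cast this
    exact_mod_cast this
  have hn0 : (0 : ℝ) < n := by linarith
  set s : ℝ := 2 / (n ^ 2 * τ) with hs
  -- `s` is four times the bound on the squared shifts, hence bounds the squared distance between
  -- any two of them.
  have hsτ : s * (n ^ 2 * τ) = 2 := by rw [hs]; field_simp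
  have hs0 : 0 < s := by positivity
  have h4 : ∀ v : E, ‖v‖ ^ 2 ≤ 1 / (2 * n ^ 2 * τ) → 4 * ‖v‖ ^ 2 ≤ s := by
    intro v hv
    have : 4 * (1 / (2 * (n : ℝ) ^ 2 * τ)) = s := by rw [hs]; field_simp; norm_num
    linarith
  rcases le_total α 2 with hα2 | hα2
  · have hs1 : s ≤ 0.715 := by
      have : (4 : ℝ) * 0.7 ≤ n ^ 2 * τ := by gcongr; nlinarith
      nlinarith
    refine (hψ.lintegral_rpow_mixture_le (K := α - 1) (k := 0) (X := 7 * s) (C₁ := 0) hw hw1 hq hQ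
      (by linarith) le_rfl (fun x y hx _ _ => ?_) (fun i => ?_) (fun i => ?_)).trans
      (ENNReal.ofReal_le_ofReal ?_)
    · simpa using rpow_le_of_le_two hα.le hα2 hx
    · exact chi_sq_le (h4 _ (ha i)) (h4 _ hb) (h4 _ hc) hs1
    · exact chi_sq_le (h4 _ (ha i)) (h4 _ hb) (h4 _ hc) hs1
    · refine le_trans ?_ (Real.add_one_le_exp _)
      -- Since `n ≥ 2`, `7 s = 14 / (n² τ) ≤ 3.5 / τ`; this case fixes the constant `3.5`.
      have h1 : 7 * s ≤ 3.5 * α / τ := by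
        rw [le_div_iff₀ hτ0]
        have : s * (4 * τ) ≤ s * (n ^ 2 * τ) := by gcongr; nlinarith
        nlinarith
      have h2 : (α - 1) * q ^ 2 * (7 * s) ≤ (α - 1) * q ^ 2 * (3.5 * α / τ) := by
        have : 0 ≤ (α - 1) * q ^ 2 := mul_nonneg (by linarith) (sq_nonneg _)
        gcongr
      have e : (α - 1) * q ^ 2 * (3.5 * α / τ) = (α - 1) * (3.5 * α * q ^ 2 / τ) := by ring
      linarith
  -- `n ≥ α (1 + τ) ≥ 2 * 1.7 > 3`, and `n` is an integer.
  · have hn4 : (4 : ℝ) ≤ n := by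
      have : (3 : ℝ) < n := by nlinarith
      have : 3 < n := by exact_mod_cast this
      exact_mod_cast this
    have hαs : α ^ 2 * s ≤ 1 := by
      have h1 : (α * (1 + τ)) ^ 2 ≤ n ^ 2 := by gcongr
      have h2 : 2 * α ^ 2 ≤ n ^ 2 * τ := by
        -- The threshold `0.7` is nearly sharp here: `1.7² * 0.7 = 2.023`.
        have h3 : 2 ≤ (1 + τ) ^ 2 * τ := by nlinarith
        calc 2 * α ^ 2 ≤ ((1 + τ) ^ 2 * τ) * α ^ 2 := by gcongr
          _ = (α * (1 + τ)) ^ 2 * τ := by ring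
          _ ≤ _ := by gcongr
      nlinarith
    refine (hψ.lintegral_rpow_mixture_le (K := α * (α - 1)) (k := α - 2) (X := 9 * s) (C₁ := 1) hw
      hw1 hq hQ (by nlinarith) zero_le_one (fun x y hx hy hxy => ?_) (fun i => ?_)
      (fun i => ?_)).trans (ENNReal.ofReal_le_ofReal ?_)
    · simpa using rpow_le_of_two_le hα2 hx hy hxy
    · exact chi_weighted_le (h4 _ (ha i)) (h4 _ hb) (h4 _ hc) le_rfl (by linarith) hαs
    · exact chi_weighted_le (h4 _ (ha i)) (h4 _ hb) (h4 _ hc) (by linarith) (by linarith) hαs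
    · refine le_trans ?_ (Real.add_one_le_exp _)
      have h1 : 18 * s ≤ 3.5 / τ := by
        rw [le_div_iff₀ hτ0]
        have : s * (16 * τ) ≤ s * (n ^ 2 * τ) := by gcongr; nlinarith
        nlinarith
      have h2 : α * (α - 1) * q ^ 2 * (18 * s) ≤ α * (α - 1) * q ^ 2 * (3.5 / τ) := by
        have : 0 ≤ α * (α - 1) * q ^ 2 := mul_nonneg (by nlinarith) (sq_nonneg _)
        gcongr
      have e : α * (α - 1) * q ^ 2 * (3.5 / τ) = (α - 1) * (3.5 * α * q ^ 2 / τ) := by ring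
      linarith

end GaussianMixtures

/-! ### Rényi closeness up to post-processing -/

/-- `P` and `Q` are the images, under a common map with values in `F`, of two measures that have
positive densities `p` and `r` with `∫ p ^ α * r ^ (1 - α) ≤ C`. -/
def RenyiClose {X : Type*} [MeasurableSpace X] (α : ℝ) (F : Set X) (P Q : Measure X)
    (C : ℝ≥0∞) : Prop :=
  ∃ (Z : Type) (_ : MeasurableSpace Z) (μ : Measure Z) (p r : Z → ℝ) (g : Z → X),
    SFinite μ ∧ Measurable p ∧ Measurable r ∧ Measurable g ∧
    (∀ z, 0 < p z) ∧ (∀ z, 0 < r z) ∧ (∀ z, g z ∈ F) ∧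
    P = (μ.withDensity fun z => ENNReal.ofReal (p z)).map g ∧
    Q = (μ.withDensity fun z => ENNReal.ofReal (r z)).map g ∧
    ∫⁻ z, ENNReal.ofReal (p z ^ α * r z ^ (1 - α)) ∂μ ≤ C

/-- Markov's inequality in pointwise form: where `p` exceeds `exp ε * r`, the factor `(p / (exp ε *
r)) ^ (α - 1)` is at least `1`. -/
theorem le_mul_add_mul_rpow {α ε p r : ℝ} (hα : 1 < α) (hp : 0 < p) (hr : 0 < r) :
    p ≤ Real.exp ε * r + Real.exp (-(ε * (α - 1))) * (p ^ α * r ^ (1 - α)) := by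
  rcases le_total p (Real.exp ε * r) with h | h
  · have : 0 < Real.exp (-(ε * (α - 1))) * (p ^ α * r ^ (1 - α)) := by positivity
    linarith
  · have hr' : 0 < Real.exp ε * r := by positivity
    have h1 : (Real.exp ε * r) ^ (α - 1) ≤ p ^ (α - 1) :=
      Real.rpow_le_rpow hr'.le h (by linarith)
    rw [Real.mul_rpow (Real.exp_nonneg _) hr.le, ← Real.exp_mul] at h1
    have e : Real.exp (-(ε * (α - 1))) * (p ^ α * r ^ (1 - α)) =
        p * (p ^ (α - 1) / (Real.exp (ε * (α - 1)) * r ^ (α - 1))) := by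
      have : (1 - α) = -(α - 1) := by ring
      rw [Real.rpow_sub_one hp.ne', this, Real.rpow_neg hr.le, Real.exp_neg]
      field_simp
    rw [e]
    have h2 : 1 ≤ p ^ (α - 1) / (Real.exp (ε * (α - 1)) * r ^ (α - 1)) := by
      rwa [one_le_div (by positivity)]
    nlinarith

theorem RenyiClose.apply_le {X : Type*} [MeasurableSpace X] {α : ℝ} {F : Set X} {P Q : Measure X}
    {C : ℝ≥0∞} (h : RenyiClose α F P Q C) (hα : 1 < α) (ε : ℝ) {A : Set X}
    (hA : MeasurableSet A) :
    P A ≤ ENNReal.ofReal (Real.exp ε) * Q A +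
      ENNReal.ofReal (Real.exp (-(ε * (α - 1)))) * C := by
  obtain ⟨Z, _, μ, p, r, g, _, hp, hr, hg, hp0, hr0, -, rfl, rfl, hC⟩ := h
  have hA' := hg hA
  rw [Measure.map_apply hg hA, Measure.map_apply hg hA, withDensity_apply _ hA',
    withDensity_apply _ hA']
  calc ∫⁻ z in g ⁻¹' A, ENNReal.ofReal (p z) ∂μ
      ≤ ∫⁻ z in g ⁻¹' A, (ENNReal.ofReal (Real.exp ε) * ENNReal.ofReal (r z) +
          ENNReal.ofReal (Real.exp (-(ε * (α - 1)))) *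
            ENNReal.ofReal (p z ^ α * r z ^ (1 - α))) ∂μ := by
        refine lintegral_mono fun z => ?_
        have h1 : 0 ≤ p z ^ α * r z ^ (1 - α) :=
          mul_nonneg (Real.rpow_nonneg (hp0 z).le _) (Real.rpow_nonneg (hr0 z).le _)
        simp only
        rw [← ENNReal.ofReal_mul (Real.exp_nonneg _), ← ENNReal.ofReal_mul (Real.exp_nonneg _),
          ← ENNReal.ofReal_add (mul_nonneg (Real.exp_nonneg _) (hr0 z).le)
            (mul_nonneg (Real.exp_nonneg _) h1)]
        exact ENNReal.ofReal_le_ofReal (le_mul_add_mul_rpow hα (hp0 z) (hr0 z))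
    _ = ENNReal.ofReal (Real.exp ε) * ∫⁻ z in g ⁻¹' A, ENNReal.ofReal (r z) ∂μ +
          ENNReal.ofReal (Real.exp (-(ε * (α - 1)))) *
            ∫⁻ z in g ⁻¹' A, ENNReal.ofReal (p z ^ α * r z ^ (1 - α)) ∂μ := by
        rw [lintegral_add_left (by fun_prop), lintegral_const_mul _ (by fun_prop),
          lintegral_const_mul _ (by fun_prop)]
    _ ≤ _ := by
        gcongr
        exact (setLIntegral_le_lintegral _ _).trans hC

theorem RenyiClose.dirac {X : Type*} [MeasurableSpace X] (α : ℝ) {F : Set X} {x : X} (hx : x ∈ F) :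
    RenyiClose α F (Measure.dirac x) (Measure.dirac x) 1 := by
  refine ⟨Unit, inferInstance, Measure.dirac (), fun _ => 1, fun _ => 1, fun _ => x, inferInstance,
    measurable_const, measurable_const, measurable_const, fun _ => one_pos, fun _ => one_pos,
    fun _ => hx, ?_, ?_, ?_⟩
  · simp
  · simp
  · simp

/-- The density of a composition is the product of the densities, and the latent variable of the
first stage is kept. The kernel is measurable because its values on sets are integrals of jointly
measurable functions. -/
theorem bind_map_withDensity {X Y Z : Type*} [MeasurableSpace X] [MeasurableSpace Y]
    [MeasurableSpace Z] {μ : Measure Z} [SFinite μ] {ρ : Measure Y} [SFinite ρ] {p : Z → ℝ}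
    {g : Z → X} {p' : X × Y → ℝ} {h : X × Y → X} (hp : Measurable p) (hg : Measurable g)
    (hp' : Measurable p') (hh : Measurable h) (hp0 : ∀ z, 0 < p z) :
    ((μ.withDensity fun z => ENNReal.ofReal (p z)).map g).bind
      (fun x => (ρ.withDensity fun y => ENNReal.ofReal (p' (x, y))).map fun y => h (x, y)) =
    ((μ.prod ρ).withDensity fun u => ENNReal.ofReal (p u.1 * p' (g u.1, u.2))).map
      fun u => h (g u.1, u.2) := by
  have hκA : ∀ A, MeasurableSet A → ∀ x,
      ((ρ.withDensity fun y => ENNReal.ofReal (p' (x, y))).map fun y => h (x, y)) A =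
      ∫⁻ y, (h ⁻¹' A).indicator (fun u => ENNReal.ofReal (p' u)) (x, y) ∂ρ := by
    intro A hA x
    have hx : Measurable fun y => h (x, y) := by fun_prop
    rw [Measure.map_apply hx hA, withDensity_apply _ (hx hA), ← lintegral_indicator (hx hA)]
    rfl
  have hind : ∀ A, MeasurableSet A →
      Measurable ((h ⁻¹' A).indicator (fun u => ENNReal.ofReal (p' u))) := fun A hA =>
    (by fun_prop : Measurable fun u => ENNReal.ofReal (p' u)).indicator (hh hA)
  have hκ : Measurable fun x =>
      (ρ.withDensity fun y => ENNReal.ofReal (p' (x, y))).map fun y => h (x, y) := by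
    refine Measure.measurable_of_measurable_coe _ fun A hA => ?_
    simp only [hκA A hA]
    exact (hind A hA).lintegral_prod_right'
  ext A hA
  have hG : Measurable fun u : Z × Y => h (g u.1, u.2) := by fun_prop
  have hm : Measurable fun x => ∫⁻ y, (h ⁻¹' A).indicator
      (fun u => ENNReal.ofReal (p' u)) (x, y) ∂ρ := (hind A hA).lintegral_prod_right'
  have hmg : Measurable fun z => ∫⁻ y, (h ⁻¹' A).indicator
      (fun u => ENNReal.ofReal (p' u)) (g z, y) ∂ρ := hm.comp hg
  have hmG : Measurable fun u : Z × Y =>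
      (h ⁻¹' A).indicator (fun u => ENNReal.ofReal (p' u)) (g u.1, u.2) :=
    (hind A hA).comp (by fun_prop)
  rw [Measure.bind_apply hA hκ.aemeasurable, Measure.map_apply hG hA, withDensity_apply _ (hG hA),
    ← lintegral_indicator (hG hA)]
  simp only [hκA A hA]
  rw [lintegral_map hm hg, lintegral_withDensity_eq_lintegral_mul _ (by fun_prop) hmg]
  have e : ∀ u : Z × Y, ((fun u : Z × Y => h (g u.1, u.2)) ⁻¹' A).indicator
      (fun u => ENNReal.ofReal (p u.1 * p' (g u.1, u.2))) u =
      ENNReal.ofReal (p u.1) *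
        (h ⁻¹' A).indicator (fun u => ENNReal.ofReal (p' u)) (g u.1, u.2) := by
    intro u
    by_cases hu : h (g u.1, u.2) ∈ A
    · rw [Set.indicator_of_mem (by exact hu), Set.indicator_of_mem (by exact hu),
        ENNReal.ofReal_mul (hp0 _).le]
    · rw [Set.indicator_of_notMem (by exact hu), Set.indicator_of_notMem (by exact hu), mul_zero]
  simp only [e]
  rw [lintegral_prod _ (by fun_prop)]
  refine lintegral_congr fun z => ?_
  exact (lintegral_const_mul _ ((hind A hA).comp (by fun_prop))).symm

/-- Adaptive composition. -/
theorem RenyiClose.bind {X : Type*} {Y : Type} [MeasurableSpace X] [MeasurableSpace Y] {α : ℝ}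
    {F : Set X} {P Q : Measure X} {C C' : ℝ≥0∞} (hPQ : RenyiClose α F P Q C)
    {κ κ' : X → Measure X} {ρ : Measure Y} [SFinite ρ] {p' r' : X × Y → ℝ} {h : X × Y → X}
    (hp' : Measurable p') (hr' : Measurable r') (hh : Measurable h)
    (hp0' : ∀ u, 0 < p' u) (hr0' : ∀ u, 0 < r' u) (hF : ∀ x ∈ F, ∀ y, h (x, y) ∈ F)
    (hκ : ∀ x, κ x = (ρ.withDensity fun y => ENNReal.ofReal (p' (x, y))).map fun y => h (x, y))
    (hκ' : ∀ x, κ' x = (ρ.withDensity fun y => ENNReal.ofReal (r' (x, y))).map fun y => h (x, y))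
    (hC' : ∀ x ∈ F, ∫⁻ y, ENNReal.ofReal (p' (x, y) ^ α * r' (x, y) ^ (1 - α)) ∂ρ ≤ C') :
    RenyiClose α F (P.bind κ) (Q.bind κ') (C * C') := by
  obtain ⟨Z, _, μ, p, r, g, _, hp, hr, hg, hp0, hr0, hgF, rfl, rfl, hC⟩ := hPQ
  refine ⟨Z × Y, inferInstance, μ.prod ρ, fun u => p u.1 * p' (g u.1, u.2),
    fun u => r u.1 * r' (g u.1, u.2), fun u => h (g u.1, u.2), inferInstance, by fun_prop,
    by fun_prop, by fun_prop, fun u => mul_pos (hp0 _) (hp0' _), fun u => mul_pos (hr0 _) (hr0' _),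
    fun u => hF _ (hgF _) _, ?_, ?_, ?_⟩
  · rw [funext hκ, bind_map_withDensity hp hg hp' hh hp0]
  · rw [funext hκ', bind_map_withDensity hr hg hr' hh hr0]
  · rw [lintegral_prod _ (by fun_prop)]
    calc _ ≤ ∫⁻ z, ENNReal.ofReal (p z ^ α * r z ^ (1 - α)) * C' ∂μ := by
          refine lintegral_mono fun z => ?_
          have h0 : 0 ≤ p z ^ α * r z ^ (1 - α) :=
            mul_nonneg (Real.rpow_nonneg (hp0 z).le _) (Real.rpow_nonneg (hr0 z).le _)
          have e : ∀ y, ENNReal.ofReal ((p z * p' (g z, y)) ^ α * (r z * r' (g z, y)) ^ (1 - α)) =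
              ENNReal.ofReal (p z ^ α * r z ^ (1 - α)) *
                ENNReal.ofReal (p' (g z, y) ^ α * r' (g z, y) ^ (1 - α)) := by
            intro y
            rw [← ENNReal.ofReal_mul h0, Real.mul_rpow (hp0 z).le (hp0' _).le,
              Real.mul_rpow (hr0 z).le (hr0' _).le]
            congr 1
            ring
          simp only [e]
          rw [lintegral_const_mul _ (by fun_prop)]
          gcongr
          exact hC' _ (hgF z)
      _ = (∫⁻ z, ENNReal.ofReal (p z ^ α * r z ^ (1 - α)) ∂μ) * C' :=
          lintegral_mul_const _ (by fun_prop)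
      _ ≤ _ := by gcongr

variable {𝒮 𝒜 : Type*} {d m n : ℕ}

/-! ### Gradients and projections -/

theorem measurable_gradθ {f : Objective 𝒮 𝒜 d} {ξ : Transition 𝒮 𝒜}
    (hf : Differentiable ℝ fun x : Vec d × Vec d => f x.1 x.2 ξ) :
    Measurable fun x : Vec d × Vec d => gradθ f x.1 x.2 ξ := by
  have h := measurable_fderiv_with_param ℝ (f := fun ω θ : Vec d => f θ ω ξ)
    (hf.continuous.comp continuous_swap)
  exact (InnerProductSpace.toDual ℝ (Vec d)).symm.continuous.measurable.comp
    (h.comp measurable_swap)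

theorem measurable_gradω {f : Objective 𝒮 𝒜 d} {ξ : Transition 𝒮 𝒜}
    (hf : Differentiable ℝ fun x : Vec d × Vec d => f x.1 x.2 ξ) :
    Measurable fun x : Vec d × Vec d => gradω f x.1 x.2 ξ := by
  have h := measurable_fderiv_with_param ℝ (f := fun θ ω : Vec d => f θ ω ξ) hf.continuous
  exact (InnerProductSpace.toDual ℝ (Vec d)).symm.continuous.measurable.comp h

/-- The averaged Lipschitz condition bounds the gradients themselves: apply it to the trajectory
that repeats one transition `n` times. -/
theorem AveragedLipschitz.norm_le {f : Objective 𝒮 𝒜 d} {Θ Ω : Set (Vec d)} {G : ℝ}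
    (h : AveragedLipschitz f Θ Ω n G) (hn : n ≠ 0) {θ ω : Vec d} (hθ : θ ∈ Θ) (hω : ω ∈ Ω)
    (ξ : Transition 𝒮 𝒜) : ‖gradθ f θ ω ξ‖ ≤ G ∧ ‖gradω f θ ω ξ‖ ≤ G := by
  have hn0 : (0 : ℝ) < n := by exact_mod_cast Nat.pos_of_ne_zero hn
  have h1 := h ⟨List.replicate n ξ, by simp [hn], by simp⟩ θ hθ ω hω
  simp only [List.map_replicate, List.sum_replicate, ← Nat.cast_smul_eq_nsmul ℝ, norm_smul,
    Real.norm_natCast] at h1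
  exact ⟨le_of_mul_le_mul_left h1.1 hn0, le_of_mul_le_mul_left h1.2 hn0⟩

theorem inner_sub_proj_le_zero {K : Set (Vec d)} (hne : K.Nonempty) (hcl : IsClosed K)
    (hcv : Convex ℝ K) (x : Vec d) {z : Vec d} (hz : z ∈ K) :
    inner ℝ (x - proj K x) (z - proj K x) ≤ 0 := by
  obtain ⟨hp, hle⟩ := proj_spec hne hcl hcv x
  refine (norm_eq_iInf_iff_real_inner_le_zero hcv hp).1 ?_ z hz
  have : Nonempty K := hne.to_subtype
  refine le_antisymm (le_ciInf fun w => hle w w.2) ?_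
  exact ciInf_le (f := fun w : K => ‖x - w‖)
    ⟨0, by rintro _ ⟨w, rfl⟩; exact norm_nonneg _⟩ ⟨_, hp⟩

/-- Adding the variational inequalities at `x` and `y` gives `‖p - q‖² ≤ ⟪x - y, p - q⟫`. The result
is needed for measurability of the updates. -/
theorem lipschitzWith_proj {K : Set (Vec d)} (hne : K.Nonempty) (hcl : IsClosed K)
    (hcv : Convex ℝ K) : LipschitzWith 1 (proj K) := by
  refine LipschitzWith.of_dist_le_mul fun x y => ?_
  rw [NNReal.coe_one, one_mul, dist_eq_norm, dist_eq_norm]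
  have h1 := inner_sub_proj_le_zero hne hcl hcv x (proj_spec hne hcl hcv y).1
  have h2 := inner_sub_proj_le_zero hne hcl hcv y (proj_spec hne hcl hcv x).1
  set p := proj K x
  set q := proj K y
  have e : inner ℝ (x - p) (q - p) + inner ℝ (y - q) (p - q) =
      ‖p - q‖ ^ 2 - inner ℝ (x - y) (p - q) := by
    have e1 : q - p = -(p - q) := by abel
    have e2 : y - q = (y - x) + ((x - p) + (p - q)) := by abel
    have e3 : x - y = -(y - x) := by abel
    rw [e1, e2, e3, inner_neg_right, inner_neg_left, inner_add_left, inner_add_left,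
      real_inner_self_eq_norm_sq]
    ring
  have h3 := real_inner_le_norm (x - y) (p - q)
  have h4 : ‖p - q‖ ^ 2 ≤ ‖x - y‖ * ‖p - q‖ := by linarith
  by_contra! hlt
  have h5 : 0 < ‖p - q‖ := lt_of_le_of_lt (norm_nonneg _) hlt
  nlinarith

/-- The states whose iterates are feasible. -/
def feasible (I : Input d) : Set (State d) := {x | x.1.1 ∈ I.Θ ∧ x.1.2 ∈ I.Ω}

theorem Input.Valid.measurable_nextIterate {I : Input d} (hI : I.Valid) (t : ℕ) :
    Measurable (nextIterate I t) := by
  have h1 := (lipschitzWith_proj ⟨_, hI.θ₀_mem⟩ hI.Θ_closed hI.Θ_convex).continuous.measurable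
  have h2 := (lipschitzWith_proj ⟨_, hI.ω₀_mem⟩ hI.Ω_closed hI.Ω_convex).continuous.measurable
  unfold nextIterate
  fun_prop

theorem Input.Valid.nextIterate_mem {I : Input d} (hI : I.Valid) (t : ℕ) {x : State d}
    (hx : x ∈ feasible I) : (nextIterate I t x).1 ∈ I.Θ ∧ (nextIterate I t x).2 ∈ I.Ω :=
  ⟨hI.Θ_convex.add_smul_sub_mem hx.1
      (proj_spec ⟨_, hI.θ₀_mem⟩ hI.Θ_closed hI.Θ_convex _).1 ⟨(hI.ν_pos t).le, hI.ν_le_one t⟩,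
    hI.Ω_convex.add_smul_sub_mem hx.2
      (proj_spec ⟨_, hI.ω₀_mem⟩ hI.Ω_closed hI.Ω_convex _).1 ⟨(hI.ν_pos t).le, hI.ν_le_one t⟩⟩

/-! ### Sampling from the dataset -/

/-- The uniform measure on `Fin k`. -/
def unifFin (k : ℕ) : Measure (Fin k) := (k : ℝ≥0∞)⁻¹ • Measure.count

theorem lintegral_unifFin {k : ℕ} (φ : Fin k → ℝ≥0∞) :
    ∫⁻ j, φ j ∂(unifFin k) = (k : ℝ≥0∞)⁻¹ * ∑ j, φ j := by
  rw [unifFin, lintegral_smul_measure, lintegral_count, tsum_fintype, smul_eq_mul]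

theorem isProbabilityMeasure_unifFin {k : ℕ} (hk : k ≠ 0) : IsProbabilityMeasure (unifFin k) := by
  constructor
  rw [← lintegral_one, lintegral_unifFin]
  simp [ENNReal.inv_mul_cancel, hk]

theorem overSample_apply {X : Type*} [MeasurableSpace X] (S : Dataset 𝒮 𝒜 m n)
    (F : Transition 𝒮 𝒜 → Measure X) (A : Set X) :
    overSample S F A = ∑ i : Fin m, ∑ j : Fin (S i).1.length,
      ((m : ℝ≥0∞)⁻¹ * ((S i).1.length : ℝ≥0∞)⁻¹) * F ((S i).1.get j) A := by
  simp [overSample, Measure.finsetSum_apply]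

theorem length_ne_zero (S : Dataset 𝒮 𝒜 m n) (i : Fin m) : (S i).1.length ≠ 0 := by
  simpa using (S i).2.1

/-- The density of the noisy gradient when the transition is sampled from `S`, except that `ξ` is
taken whenever the trajectory `i₀` is drawn; `sh ξ` is the (normalized) gradient at `ξ`. -/
def mixDensity (S : Dataset 𝒮 𝒜 m n) (i₀ : Fin m) (sh : Transition 𝒮 𝒜 → Vec d × Vec d)
    (ξ : Transition 𝒮 𝒜) (z : Vec d × Vec d) : ℝ :=
  ∑ i : Fin m, ∑ j : Fin (S i).1.length, ((m : ℝ)⁻¹ * ((S i).1.length : ℝ)⁻¹) *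
    gaussDensity (WithLp.toLp 2 (sh (if i = i₀ then ξ else (S i).1.get j))) (WithLp.toLp 2 z)

/-- Only one Gaussian of weight `1 / m` depends on `ξ`. This yields both `P - Q = q (D_b - D_c)` and
`Q ≥ q D_c`. -/
theorem mixDensity_eq (S : Dataset 𝒮 𝒜 m n) (i₀ : Fin m)
    (sh : Transition 𝒮 𝒜 → Vec d × Vec d) (ξ : Transition 𝒮 𝒜) (z : Vec d × Vec d) :
    mixDensity S i₀ sh ξ z =
      (m : ℝ)⁻¹ * gaussDensity (WithLp.toLp 2 (sh ξ)) (WithLp.toLp 2 z) +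
      ∑ i ∈ Finset.univ.erase i₀, ∑ j : Fin (S i).1.length,
        ((m : ℝ)⁻¹ * ((S i).1.length : ℝ)⁻¹) *
          gaussDensity (WithLp.toLp 2 (sh ((S i).1.get j))) (WithLp.toLp 2 z) := by
  rw [mixDensity, ← Finset.add_sum_erase _ _ (Finset.mem_univ i₀)]
  congr 1
  · have : ((S i₀).1.length : ℝ) ≠ 0 := by exact_mod_cast length_ne_zero S i₀
    simp only [if_true, Finset.sum_const, Finset.card_univ, Fintype.card_fin, nsmul_eq_mul]
    field_simp
  · refine Finset.sum_congr rfl fun i hi => ?_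
    simp only [if_neg (Finset.ne_of_mem_erase hi)]

theorem inv_mul_gaussDensity_le_mixDensity (S : Dataset 𝒮 𝒜 m n) (i₀ : Fin m)
    (sh : Transition 𝒮 𝒜 → Vec d × Vec d) (ξ : Transition 𝒮 𝒜) (z : Vec d × Vec d) :
    (m : ℝ)⁻¹ * gaussDensity (WithLp.toLp 2 (sh ξ)) (WithLp.toLp 2 z) ≤
      mixDensity S i₀ sh ξ z := by
  rw [mixDensity_eq]
  refine le_add_of_nonneg_right (Finset.sum_nonneg fun i _ => Finset.sum_nonneg fun j _ => ?_)
  exact mul_nonneg (by positivity) (gaussDensity_pos _ _).le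

theorem mixDensity_pos (S : Dataset 𝒮 𝒜 m n) (i₀ : Fin m)
    (sh : Transition 𝒮 𝒜 → Vec d × Vec d) (ξ : Transition 𝒮 𝒜) (z : Vec d × Vec d) :
    0 < mixDensity S i₀ sh ξ z := by
  have hm : (0 : ℝ) < m := by exact_mod_cast i₀.pos
  exact (mul_pos (inv_pos.2 hm) (gaussDensity_pos _ _)).trans_le
    (inv_mul_gaussDensity_le_mixDensity S i₀ sh ξ z)

theorem ofReal_mixDensity (S : Dataset 𝒮 𝒜 m n) (i₀ : Fin m)
    (sh : Transition 𝒮 𝒜 → Vec d × Vec d) (ξ : Transition 𝒮 𝒜) (z : Vec d × Vec d) :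
    ENNReal.ofReal (mixDensity S i₀ sh ξ z) =
      ∑ i : Fin m, ∑ j : Fin (S i).1.length, ((m : ℝ≥0∞)⁻¹ * ((S i).1.length : ℝ≥0∞)⁻¹) *
        ENNReal.ofReal (gaussDensity
          (WithLp.toLp 2 (sh (if i = i₀ then ξ else (S i).1.get j))) (WithLp.toLp 2 z)) := by
  have hm : (0 : ℝ) < m := by exact_mod_cast i₀.pos
  have h0 : ∀ (i : Fin m) (j : Fin (S i).1.length), 0 ≤ ((m : ℝ)⁻¹ * ((S i).1.length : ℝ)⁻¹) *
      gaussDensity (WithLp.toLp 2 (sh (if i = i₀ then ξ else (S i).1.get j)))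
        (WithLp.toLp 2 z) := fun i j => mul_nonneg (by positivity) (gaussDensity_pos _ _).le
  rw [mixDensity, ENNReal.ofReal_sum_of_nonneg fun i _ => Finset.sum_nonneg fun j _ => h0 i j]
  refine Finset.sum_congr rfl fun i _ => ?_
  have hl : (0 : ℝ) < (S i).1.length := by exact_mod_cast Nat.pos_of_ne_zero (length_ne_zero S i)
  rw [ENNReal.ofReal_sum_of_nonneg fun j _ => h0 i j]
  refine Finset.sum_congr rfl fun j _ => ?_
  rw [ENNReal.ofReal_mul (by positivity), ENNReal.ofReal_mul (by positivity),
    ENNReal.ofReal_inv_of_pos hm, ENNReal.ofReal_inv_of_pos hl, ENNReal.ofReal_natCast,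
    ENNReal.ofReal_natCast]

theorem measurable_gaussDensity_toLp {X : Type*} [MeasurableSpace X] {g h : X → Vec d × Vec d}
    (hg : Measurable g) (hh : Measurable h) :
    Measurable fun x => gaussDensity (WithLp.toLp 2 (g x)) (WithLp.toLp 2 (h x)) := by
  have e : ∀ x, gaussDensity (WithLp.toLp 2 (g x)) (WithLp.toLp 2 (h x)) =
      Real.exp (inner ℝ (g x).1 (h x).1 + inner ℝ (g x).2 (h x).2 -
        (‖(g x).1‖ ^ 2 + ‖(g x).2‖ ^ 2) / 2) := by
    intro x
    rw [gaussDensity, inner_toLp_prod, WithLp.prod_norm_sq_eq_of_L2]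
    rfl
  simp only [e]
  fun_prop

/-- Transitions carry no σ-algebra, so the chosen transition is parametrized by a countable index
and measurability is checked for each index. -/
theorem measurable_mixDensity {X : Type*} [MeasurableSpace X] (S : Dataset 𝒮 𝒜 m n) (i₀ : Fin m)
    {sh : X → Transition 𝒮 𝒜 → Vec d × Vec d} (hsh : ∀ ξ, Measurable fun x => sh x ξ)
    {K : Type*} [MeasurableSpace K] [Countable K] [MeasurableSingletonClass K]
    (ξ : K → Transition 𝒮 𝒜) :
    Measurable fun u : X × (K × (Vec d × Vec d)) => mixDensity S i₀ (sh u.1) (ξ u.2.1) u.2.2 := by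
  have hm : ∀ ξ', Measurable fun u : X × (Vec d × Vec d) =>
      mixDensity S i₀ (sh u.1) ξ' u.2 := by
    intro ξ'
    unfold mixDensity
    refine Finset.measurable_fun_sum _ fun i _ => Finset.measurable_fun_sum _ fun j _ => ?_
    refine Measurable.const_mul ?_ _
    exact measurable_gaussDensity_toLp ((hsh _).comp measurable_fst) measurable_snd
  have h : Measurable fun u : K × (X × (Vec d × Vec d)) =>
      mixDensity S i₀ (sh u.2.1) (ξ u.1) u.2.2 :=
    measurable_from_prod_countable_right fun k => hm (ξ k)
  have hr : Measurable fun u : X × (K × (Vec d × Vec d)) => (u.2.1, (u.1, u.2.2)) := by fun_prop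
  have h2 := h.comp hr
  simp only [Function.comp_def] at h2
  exact h2

theorem setLIntegral_mixDensity (S : Dataset 𝒮 𝒜 m n) (i₀ : Fin m)
    (sh : Transition 𝒮 𝒜 → Vec d × Vec d) (ξ : Transition 𝒮 𝒜) (A : Set (Vec d × Vec d)) :
    ∫⁻ z in A, ENNReal.ofReal (mixDensity S i₀ sh ξ z) ∂(stdPair d) =
      ∑ i : Fin m, ∑ j : Fin (S i).1.length, ((m : ℝ≥0∞)⁻¹ * ((S i).1.length : ℝ≥0∞)⁻¹) *
        ∫⁻ z in A, ENNReal.ofReal (gaussDensity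
          (WithLp.toLp 2 (sh (if i = i₀ then ξ else (S i).1.get j))) (WithLp.toLp 2 z))
            ∂(stdPair d) := by
  have hme : ∀ ξ', Measurable fun z : Vec d × Vec d => ENNReal.ofReal
      (gaussDensity (WithLp.toLp 2 (sh ξ')) (WithLp.toLp 2 z)) := fun ξ' =>
    (measurable_gaussDensity_toLp measurable_const measurable_id).ennreal_ofReal
  simp only [ofReal_mixDensity]
  rw [lintegral_finsetSum _ fun i _ => Finset.measurable_fun_sum _ fun j _ => (hme _).const_mul _]
  refine Finset.sum_congr rfl fun i _ => ?_
  rw [lintegral_finsetSum _ fun j _ => (hme _).const_mul _]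
  exact Finset.sum_congr rfl fun j _ => lintegral_const_mul _ (hme _)

/-- Sampling a transition of the trajectory `i₀` first, and then sampling from the dataset with
that transition used whenever the trajectory `i₀` is drawn. -/
theorem sum_overSample_eq (S S' : Dataset 𝒮 𝒜 m n) (i₀ : Fin m) (hS : ∀ i ≠ i₀, S' i = S i)
    (φ : Transition 𝒮 𝒜 → ℝ≥0∞) :
    ∑ i : Fin m, ∑ j : Fin (S' i).1.length,
      ((m : ℝ≥0∞)⁻¹ * ((S' i).1.length : ℝ≥0∞)⁻¹) * φ ((S' i).1.get j) =
    ∫⁻ k, (∑ i : Fin m, ∑ j : Fin (S i).1.length,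
      ((m : ℝ≥0∞)⁻¹ * ((S i).1.length : ℝ≥0∞)⁻¹) *
        φ (if i = i₀ then (S' i₀).1.get k else (S i).1.get j)) ∂(unifFin (S' i₀).1.length) := by
  have := isProbabilityMeasure_unifFin (length_ne_zero S' i₀)
  have e : ∀ k, ∑ i : Fin m, ∑ j : Fin (S i).1.length,
      ((m : ℝ≥0∞)⁻¹ * ((S i).1.length : ℝ≥0∞)⁻¹) *
        φ (if i = i₀ then (S' i₀).1.get k else (S i).1.get j) =
      (m : ℝ≥0∞)⁻¹ * φ ((S' i₀).1.get k) + ∑ i ∈ Finset.univ.erase i₀,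
        ∑ j : Fin (S i).1.length, ((m : ℝ≥0∞)⁻¹ * ((S i).1.length : ℝ≥0∞)⁻¹) *
          φ ((S i).1.get j) := by
    intro k
    rw [← Finset.add_sum_erase _ _ (Finset.mem_univ i₀)]
    congr 1
    · have h0 : ((S i₀).1.length : ℝ≥0∞) ≠ 0 := by exact_mod_cast length_ne_zero S i₀
      simp only [if_true, Finset.sum_const, Finset.card_univ, Fintype.card_fin, nsmul_eq_mul]
      rw [← mul_assoc, mul_comm (m : ℝ≥0∞)⁻¹, ← mul_assoc,
        ENNReal.mul_inv_cancel h0 (ENNReal.natCast_ne_top _), one_mul]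
    · refine Finset.sum_congr rfl fun i hi => ?_
      simp only [if_neg (Finset.ne_of_mem_erase hi)]
  simp only [e]
  rw [lintegral_add_right _ measurable_const, lintegral_const, measure_univ, mul_one,
    lintegral_unifFin, ← Finset.add_sum_erase _ _ (Finset.mem_univ i₀)]
  congr 1
  · rw [← Finset.mul_sum, ← Finset.mul_sum]
    ring
  · refine Finset.sum_congr rfl fun i hi => ?_
    rw [hS i (Finset.ne_of_mem_erase hi)]

/-- `K` may be larger than the index set of the trajectory: two datasets can then be represented
over one latent space, each reading its own coordinate through `k`. -/
theorem overSample_eq_map_withDensity {X : Type*} [MeasurableSpace X] (S S' : Dataset 𝒮 𝒜 m n)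
    (i₀ : Fin m) (hS : ∀ i ≠ i₀, S' i = S i) (sh : Transition 𝒮 𝒜 → Vec d × Vec d)
    {K : Type*} [MeasurableSpace K] [Countable K] [MeasurableSingletonClass K]
    {U : Measure K} [SFinite U] {k : K → Fin (S' i₀).1.length}
    (hk : MeasurePreserving k U (unifFin (S' i₀).1.length))
    {h : Vec d × Vec d → X} (hh : Measurable h) :
    overSample S' (fun ξ => ((stdPair d).withDensity fun z => ENNReal.ofReal
        (gaussDensity (WithLp.toLp 2 (sh ξ)) (WithLp.toLp 2 z))).map h) =
      ((U.prod (stdPair d)).withDensity fun y =>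
        ENNReal.ofReal (mixDensity S i₀ sh ((S' i₀).1.get (k y.1)) y.2)).map fun y => h y.2 := by
  ext A hA
  have hA' := hh hA
  have hh2 : Measurable fun y : K × (Vec d × Vec d) => h y.2 := by fun_prop
  have hmm := (measurable_mixDensity (X := Unit) S i₀ (sh := fun _ => sh)
    (fun _ => measurable_const) (fun κ : K => (S' i₀).1.get (k κ))).comp
    (by fun_prop : Measurable fun y : K × (Vec d × Vec d) => ((), y))
  have hmm' : Measurable fun y : K × (Vec d × Vec d) =>
    ENNReal.ofReal (mixDensity S i₀ sh ((S' i₀).1.get (k y.1)) y.2) := hmm.ennreal_ofReal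
  rw [overSample_apply, Measure.map_apply hh2 hA, withDensity_apply _ (hh2 hA)]
  simp only [Measure.map_apply hh hA, withDensity_apply _ hA']
  rw [sum_overSample_eq S S' i₀ hS (fun ξ => ∫⁻ z in h ⁻¹' A, ENNReal.ofReal
        (gaussDensity (WithLp.toLp 2 (sh ξ)) (WithLp.toLp 2 z)) ∂(stdPair d)),
    ← hk.lintegral_comp (Measurable.of_discrete)]
  simp only [← setLIntegral_mixDensity]
  have e : (fun y : K × (Vec d × Vec d) => h y.2) ⁻¹' A = Set.univ ×ˢ (h ⁻¹' A) := by
    ext y; simp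
  rw [e, ← Measure.prod_restrict, Measure.restrict_univ, lintegral_prod _ hmm'.aemeasurable]

/-! ### Privacy of one step -/

theorem hasStdGaussianMGF_stdPair (d : ℕ) :
    HasStdGaussianMGF (fun z : Vec d × Vec d => WithLp.toLp 2 z) (stdPair d) :=
  ⟨integrable_exp_inner_stdPair, integral_exp_inner_stdPair⟩

/-- The moment bound for two neighbouring sampling schemes. -/
theorem lintegral_mixDensity_rpow_le (S : Dataset 𝒮 𝒜 m n) (i₀ : Fin m)
    {sh : Transition 𝒮 𝒜 → Vec d × Vec d} {α τ : ℝ} (hα : 1 < α) (hτ : 0.7 ≤ τ)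
    (hn : α * (1 + τ) ≤ n)
    (hsh : ∀ ξ, ‖(WithLp.toLp 2 (sh ξ) : WithLp 2 (Vec d × Vec d))‖ ^ 2 ≤ 1 / (2 * n ^ 2 * τ))
    (ξ ξ' : Transition 𝒮 𝒜) :
    ∫⁻ z, ENNReal.ofReal (mixDensity S i₀ sh ξ z ^ α * mixDensity S i₀ sh ξ' z ^ (1 - α))
        ∂(stdPair d) ≤
      ENNReal.ofReal (Real.exp ((α - 1) * (3.5 * α * (m : ℝ)⁻¹ ^ 2 / τ))) := by
  have hm : (0 : ℝ) < m := by exact_mod_cast i₀.pos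
  have hr : ∀ x : WithLp 2 (Vec d × Vec d), mixDensity S i₀ sh ξ' x.ofLp =
      ∑ s : (i : Fin m) × Fin (S i).1.length, ((m : ℝ)⁻¹ * ((S s.1).1.length : ℝ)⁻¹) *
        gaussDensity (WithLp.toLp 2 (sh (if s.1 = i₀ then ξ' else (S s.1).1.get s.2))) x := by
    intro x
    rw [mixDensity, Fintype.sum_sigma]
  have h := (hasStdGaussianMGF_stdPair d).lintegral_rpow_mixture_le_exp
    (w := fun s : (i : Fin m) × Fin (S i).1.length => (m : ℝ)⁻¹ * ((S s.1).1.length : ℝ)⁻¹)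
    (a := fun s => WithLp.toLp 2 (sh (if s.1 = i₀ then ξ' else (S s.1).1.get s.2)))
    (b := WithLp.toLp 2 (sh ξ)) (c := WithLp.toLp 2 (sh ξ')) (q := (m : ℝ)⁻¹)
    (fun s => by positivity) ?_ (inv_pos.2 hm) ?_ hα hτ hn (fun s => hsh _) (hsh _) (hsh _)
  · refine (lintegral_congr fun z => ?_).trans_le h
    rw [← hr]
    simp only
    have e : mixDensity S i₀ sh ξ z = mixDensity S i₀ sh ξ' z + (m : ℝ)⁻¹ *
        (gaussDensity (WithLp.toLp 2 (sh ξ)) (WithLp.toLp 2 z) -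
          gaussDensity (WithLp.toLp 2 (sh ξ')) (WithLp.toLp 2 z)) := by
      rw [mixDensity_eq, mixDensity_eq]
      ring
    rw [e]
  · rw [Fintype.sum_sigma]
    have : ∀ i : Fin m, ∑ _j : Fin (S i).1.length, (m : ℝ)⁻¹ * ((S i).1.length : ℝ)⁻¹ =
        (m : ℝ)⁻¹ := by
      intro i
      have : ((S i).1.length : ℝ) ≠ 0 := by exact_mod_cast length_ne_zero S i
      simp only [Finset.sum_const, Finset.card_univ, Fintype.card_fin, nsmul_eq_mul]
      field_simp
    simp only [this]
    simp [hm.ne']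
  · intro x
    rw [← hr]
    exact inv_mul_gaussDensity_le_mixDensity S i₀ sh ξ' x.ofLp

/-- The law of the state after a step to the iterate `nxt x`, with the gradient estimates updated
from the base point `c x` with weights `a` and `b`. -/
def gradStep (f : Objective 𝒮 𝒜 d) (v a b : ℝ) (nxt c : State d → Vec d × Vec d)
    (S : Dataset 𝒮 𝒜 m n) (x : State d) : Measure (State d) :=
  overSample S fun ξ => (noisePair d v).map fun u =>
    (nxt x, ((c x).1 + a • gradθ f (nxt x).1 (nxt x).2 ξ + u.1,
      (c x).2 + b • gradω f (nxt x).1 (nxt x).2 ξ + u.2))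

/-- The gradient at the iterate `y`, in units of the noise. -/
def gradShift (f : Objective 𝒮 𝒜 d) (v a b : ℝ) (y : Vec d × Vec d) (ξ : Transition 𝒮 𝒜) :
    Vec d × Vec d :=
  (Real.sqrt v)⁻¹ • (a • gradθ f y.1 y.2 ξ, b • gradω f y.1 y.2 ξ)

theorem gradStep_eq {f : Objective 𝒮 𝒜 d} {v a b : ℝ} (hv : 0 < v)
    {nxt c : State d → Vec d × Vec d} (S : Dataset 𝒮 𝒜 m n) (x : State d) :
    gradStep f v a b nxt c S x = overSample S fun ξ => ((stdPair d).withDensity fun z =>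
      ENNReal.ofReal (gaussDensity (WithLp.toLp 2 (gradShift f v a b (nxt x) ξ))
        (WithLp.toLp 2 z))).map fun z => (nxt x, c x + Real.sqrt v • z) := by
  unfold gradStep
  congr 1
  funext ξ
  have h := congrArg (Measure.map fun w => (nxt x, c x + w)) (map_add_noisePair hv
    (a • gradθ f (nxt x).1 (nxt x).2 ξ, b • gradω f (nxt x).1 (nxt x).2 ξ))
  rw [Measure.map_map (by fun_prop) (by fun_prop), Measure.map_map (by fun_prop) (by fun_prop)] at h
  refine Eq.trans ?_ h
  congr 1
  funext u
  simp only [Function.comp_apply, Prod.mk.injEq, true_and]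
  ext1 <;> simp [add_assoc]

/-- Averaging weights in `[0, 1]` only shrink the gradients; the factor `2` counts the primal and
the dual gradient. -/
theorem norm_gradShift_sq_le {f : Objective 𝒮 𝒜 d} {v a b G : ℝ} (hv : 0 < v)
    (ha : a ∈ Set.Icc (0 : ℝ) 1) (hb : b ∈ Set.Icc (0 : ℝ) 1) {y : Vec d × Vec d}
    {ξ : Transition 𝒮 𝒜} (hG : ‖gradθ f y.1 y.2 ξ‖ ≤ G ∧ ‖gradω f y.1 y.2 ξ‖ ≤ G) :
    ‖(WithLp.toLp 2 (gradShift f v a b y ξ) : WithLp 2 (Vec d × Vec d))‖ ^ 2 ≤ 2 * G ^ 2 / v := by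
  have h : ∀ (t : ℝ) (g : Vec d), t ∈ Set.Icc (0 : ℝ) 1 → ‖g‖ ≤ G →
      ‖(Real.sqrt v)⁻¹ • t • g‖ ^ 2 ≤ G ^ 2 / v := by
    intro t g ht hg
    have h1 : ‖t • g‖ ≤ G := by
      rw [norm_smul, Real.norm_of_nonneg ht.1]
      exact (mul_le_of_le_one_left (norm_nonneg _) ht.2).trans hg
    rw [norm_smul, mul_pow, norm_inv, inv_pow, Real.norm_of_nonneg (Real.sqrt_nonneg _),
      Real.sq_sqrt hv.le, inv_mul_eq_div]
    gcongr
  rw [WithLp.prod_norm_sq_eq_of_L2]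
  have := add_le_add (h a _ ha hG.1) (h b _ hb hG.2)
  calc _ ≤ G ^ 2 / v + G ^ 2 / v := this
    _ = _ := by ring

theorem measurable_gradShift {f : Objective 𝒮 𝒜 d}
    (hf : ∀ ξ, Differentiable ℝ fun x : Vec d × Vec d => f x.1 x.2 ξ) {v a b : ℝ}
    (ξ : Transition 𝒮 𝒜) : Measurable fun y => gradShift f v a b y ξ := by
  unfold gradShift
  have hθ := measurable_gradθ (hf ξ)
  have hω := measurable_gradω (hf ξ)
  fun_prop

theorem RenyiClose.bind_gradStep {f : Objective 𝒮 𝒜 d}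
    (hf : ∀ ξ, Differentiable ℝ fun x : Vec d × Vec d => f x.1 x.2 ξ) {I : Input d}
    {G v a b α τ : ℝ} (hG : 0 < G) (hLip : AveragedLipschitz f I.Θ I.Ω n G)
    (hv : 0 < v) (ha : a ∈ Set.Icc (0 : ℝ) 1) (hb : b ∈ Set.Icc (0 : ℝ) 1)
    (hα : 1 < α) (hτ : 0.7 ≤ τ) (hτv : τ = v / (4 * n ^ 2 * G ^ 2)) (hn : α * (1 + τ) ≤ n)
    {nxt c : State d → Vec d × Vec d} (hnxt : Measurable nxt) (hc : Measurable c)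
    (hmem : ∀ x ∈ feasible I, (nxt x).1 ∈ I.Θ ∧ (nxt x).2 ∈ I.Ω)
    {S S' : Dataset 𝒮 𝒜 m n} {i₀ : Fin m} (hS : ∀ i ≠ i₀, S' i = S i)
    {P Q : Measure (State d)} {C : ℝ≥0∞} (hPQ : RenyiClose α (feasible I) P Q C) :
    RenyiClose α (feasible I) (P.bind (gradStep f v a b nxt c S))
      (Q.bind (gradStep f v a b nxt c S'))
      (C * ENNReal.ofReal (Real.exp ((α - 1) * (3.5 * α * (m : ℝ)⁻¹ ^ 2 / τ)))) := by
  have hn0 : n ≠ 0 := by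
    rintro rfl
    norm_num at hn
    nlinarith
  have hn0' : (0 : ℝ) < n := by exact_mod_cast Nat.pos_of_ne_zero hn0
  have := isProbabilityMeasure_unifFin (length_ne_zero S i₀)
  have := isProbabilityMeasure_unifFin (length_ne_zero S' i₀)
  -- The two exceptional trajectories may have different lengths, so their transitions are drawn
  -- independently. The moment bound holds for every pair drawn, hence after averaging.
  set U := (unifFin (S i₀).1.length).prod (unifFin (S' i₀).1.length)
  have hmeas : ∀ g : Fin (S i₀).1.length × Fin (S' i₀).1.length → Transition 𝒮 𝒜,
      Measurable fun u : State d × ((Fin (S i₀).1.length × Fin (S' i₀).1.length) ×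
        (Vec d × Vec d)) => mixDensity S i₀ (gradShift f v a b (nxt u.1)) (g u.2.1) u.2.2 :=
    fun g => measurable_mixDensity S i₀ (sh := fun x => gradShift f v a b (nxt x))
      (fun ξ => (measurable_gradShift hf ξ).comp hnxt) g
  refine hPQ.bind (ρ := U.prod (stdPair d))
    (p' := fun u => mixDensity S i₀ (gradShift f v a b (nxt u.1)) ((S i₀).1.get u.2.1.1) u.2.2)
    (r' := fun u => mixDensity S i₀ (gradShift f v a b (nxt u.1)) ((S' i₀).1.get u.2.1.2) u.2.2)
    (h := fun u => (nxt u.1, c u.1 + Real.sqrt v • u.2.2))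
    (hmeas fun k => (S i₀).1.get k.1) (hmeas fun k => (S' i₀).1.get k.2) (by fun_prop)
    (fun u => mixDensity_pos _ _ _ _ _) (fun u => mixDensity_pos _ _ _ _ _)
    (fun x hx y => hmem x hx) (fun x => ?_) (fun x => ?_) (fun x hx => ?_)
  · rw [gradStep_eq hv]
    exact overSample_eq_map_withDensity S S i₀ (fun _ _ => rfl) (gradShift f v a b (nxt x))
      (measurePreserving_fst (μ := unifFin (S i₀).1.length) (ν := unifFin (S' i₀).1.length))
      (h := fun z => (nxt x, c x + Real.sqrt v • z)) (by fun_prop)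
  · rw [gradStep_eq hv]
    exact overSample_eq_map_withDensity S S' i₀ hS (gradShift f v a b (nxt x))
      (measurePreserving_snd (μ := unifFin (S i₀).1.length) (ν := unifFin (S' i₀).1.length))
      (h := fun z => (nxt x, c x + Real.sqrt v • z)) (by fun_prop)
  · have hsh : ∀ ξ, ‖(WithLp.toLp 2 (gradShift f v a b (nxt x) ξ) : WithLp 2 (Vec d × Vec d))‖ ^ 2
        ≤ 1 / (2 * n ^ 2 * τ) := by
      intro ξ
      refine (norm_gradShift_sq_le hv ha hb
        (hLip.norm_le hn0 (hmem x hx).1 (hmem x hx).2 ξ)).trans_eq ?_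
      rw [hτv]
      field_simp
      norm_num
    have hk : ∀ k : Fin (S i₀).1.length × Fin (S' i₀).1.length, _ ≤ _ := fun k =>
      lintegral_mixDensity_rpow_le S i₀ hα hτ hn hsh ((S i₀).1.get k.1) ((S' i₀).1.get k.2)
    dsimp only
    refine (lintegral_prod_le _).trans ?_
    dsimp only
    calc _ ≤ ∫⁻ _, ENNReal.ofReal (Real.exp ((α - 1) * (3.5 * α * (m : ℝ)⁻¹ ^ 2 / τ))) ∂U :=
          lintegral_mono hk
      _ = _ := by rw [lintegral_const, measure_univ, mul_one]

theorem stepLaw_eq_gradStep (I : Input d) (f : Objective 𝒮 𝒜 d) (S : Dataset 𝒮 𝒜 m n) (t : ℕ) :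
    stepLaw I f S t = gradStep f (I.σsq (t + 1)) (I.α * I.ν t) (I.β * I.ν t) (nextIterate I t)
      (fun x => ((1 - I.α * I.ν t) • x.2.1, (1 - I.β * I.ν t) • x.2.2)) S := rfl

/-- The initial draw becomes a step with weight `1` and base point `0` from a deterministic state,
so the one-step bound covers it. -/
theorem initLaw_eq_bind_gradStep (I : Input d) (f : Objective 𝒮 𝒜 d) (S : Dataset 𝒮 𝒜 m n) :
    initLaw I f S = (Measure.dirac ((I.θ₀, I.ω₀), (0, 0))).bind
      (gradStep f (I.σsq 0) 1 1 (fun _ => (I.θ₀, I.ω₀)) (fun _ => (0, 0)) S) := by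
  rw [Measure.dirac_bind (by unfold gradStep; exact measurable_const)]
  simp [gradStep, initLaw]

/-- The factor `t + 1` counts the initial draw together with the `t` updates. -/
theorem renyiClose_stateLaw {f : Objective 𝒮 𝒜 d}
    (hf : ∀ ξ, Differentiable ℝ fun x : Vec d × Vec d => f x.1 x.2 ξ) {I : Input d} (hI : I.Valid)
    {G v α τ : ℝ} (hG : 0 < G) (hLip : AveragedLipschitz f I.Θ I.Ω n G)
    (hv : 0 < v) (hσ : ∀ t, I.σsq t = v)
    (hα : 1 < α) (hτ : 0.7 ≤ τ) (hτv : τ = v / (4 * n ^ 2 * G ^ 2)) (hn : α * (1 + τ) ≤ n)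
    {S S' : Dataset 𝒮 𝒜 m n} {i₀ : Fin m} (hS : ∀ i ≠ i₀, S' i = S i) (t : ℕ) :
    RenyiClose α (feasible I) (stateLaw I f S t) (stateLaw I f S' t)
      (ENNReal.ofReal (Real.exp ((t + 1) * ((α - 1) * (3.5 * α * (m : ℝ)⁻¹ ^ 2 / τ))))) := by
  induction t with
  | zero =>
    have h := (RenyiClose.dirac α (F := feasible I) (x := ((I.θ₀, I.ω₀), (0, 0)))
      ⟨hI.θ₀_mem, hI.ω₀_mem⟩).bind_gradStep hf hG hLip hv (a := 1) (b := 1) (by simp) (by simp) hα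
      hτ hτv hn (nxt := fun _ => (I.θ₀, I.ω₀)) (c := fun _ => (0, 0)) measurable_const
      measurable_const (fun _ _ => ⟨hI.θ₀_mem, hI.ω₀_mem⟩) hS
    have h0 := initLaw_eq_bind_gradStep I f S
    have h0' := initLaw_eq_bind_gradStep I f S'
    rw [hσ] at h0 h0'
    rw [← h0, ← h0'] at h
    simpa [stateLaw] using h
  | succ t ih =>
    have h := ih.bind_gradStep hf hG hLip hv (a := I.α * I.ν t) (b := I.β * I.ν t)
      ⟨(mul_pos hI.α_pos (hI.ν_pos t)).le, hI.αν_le_one t⟩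
      ⟨(mul_pos hI.β_pos (hI.ν_pos t)).le, hI.βν_le_one t⟩ hα hτ hτv hn
      (hI.measurable_nextIterate t)
      (c := fun x => ((1 - I.α * I.ν t) • x.2.1, (1 - I.β * I.ν t) • x.2.2)) (by fun_prop)
      (fun x hx => hI.nextIterate_mem t hx) hS
    rw [← ENNReal.ofReal_mul (Real.exp_nonneg _), ← Real.exp_add] at h
    rw [stateLaw, stateLaw, stepLaw_eq_gradStep, stepLaw_eq_gradStep, hσ]
    convert h using 3
    push_cast
    ring

/-! ### Total mass -/

theorem overSample_apply_le_one {X : Type*} [MeasurableSpace X] (S : Dataset 𝒮 𝒜 m n)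
    {F : Transition 𝒮 𝒜 → Measure X} {A : Set X} (hF : ∀ ξ, F ξ A ≤ 1) :
    overSample S F A ≤ 1 := by
  rw [overSample_apply]
  calc _ ≤ ∑ i : Fin m, (m : ℝ≥0∞)⁻¹ := by
        refine Finset.sum_le_sum fun i _ => ?_
        calc _ ≤ ∑ _j : Fin (S i).1.length, (m : ℝ≥0∞)⁻¹ * ((S i).1.length : ℝ≥0∞)⁻¹ :=
              Finset.sum_le_sum fun j _ => mul_le_of_le_one_right' (hF _)
          _ = (m : ℝ≥0∞)⁻¹ * (((S i).1.length : ℝ≥0∞) * ((S i).1.length : ℝ≥0∞)⁻¹) := by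
              simp only [Finset.sum_const, Finset.card_univ, Fintype.card_fin, nsmul_eq_mul]
              ring
          _ ≤ _ := mul_le_of_le_one_right' (ENNReal.mul_inv_le_one _)
    _ ≤ 1 := by
        simp only [Finset.sum_const, Finset.card_univ, Fintype.card_fin, nsmul_eq_mul]
        exact ENNReal.mul_inv_le_one _

theorem map_noisePair_apply_le_one {X : Type*} [MeasurableSpace X] (d : ℕ) (v : ℝ)
    {g : Vec d × Vec d → X} (hg : Measurable g) {A : Set X} (hA : MeasurableSet A) :
    (noisePair d v).map g A ≤ 1 := by
  have : IsProbabilityMeasure (noisePair d v) := by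
    rw [noisePair_eq_map_stdPair]
    exact Measure.isProbabilityMeasure_map (by fun_prop)
  rw [Measure.map_apply hg hA]
  exact prob_le_one

/-- Settles the case `δ ≥ 1`. An upper bound suffices there, and `Measure.bind_apply_le` gives it
without measurability of the step kernel. -/
theorem stateLaw_apply_le_one (I : Input d) (f : Objective 𝒮 𝒜 d) (S : Dataset 𝒮 𝒜 m n) (t : ℕ)
    {A : Set (State d)} (hA : MeasurableSet A) : stateLaw I f S t A ≤ 1 := by
  induction t generalizing A with
  | zero => exact overSample_apply_le_one S fun ξ => map_noisePair_apply_le_one d _ (by fun_prop) hA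
  | succ t ih =>
    calc stateLaw I f S (t + 1) A ≤ ∫⁻ x, stepLaw I f S t x A ∂(stateLaw I f S t) :=
          Measure.bind_apply_le _ hA
      _ ≤ ∫⁻ _, 1 ∂(stateLaw I f S t) := lintegral_mono fun x =>
          overSample_apply_le_one S fun ξ => map_noisePair_apply_le_one d _ (by fun_prop) hA
      _ ≤ 1 := by
          rw [lintegral_one]
          exact ih MeasurableSet.univ

/-- A privacy guarantee for every iterate is one for the output. -/
theorem outputLaw_apply_le {I : Input d} {f : Objective 𝒮 𝒜 d} {T : ℕ} {S S' : Dataset 𝒮 𝒜 m n}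
    {c δ : ℝ≥0∞} (h : ∀ t < T, ∀ B, MeasurableSet B →
      stateLaw I f S t B ≤ c * stateLaw I f S' t B + δ)
    {A : Set (Vec d × Vec d)} (hA : MeasurableSet A) :
    outputLaw I f T S A ≤ c * outputLaw I f T S' A + δ := by
  simp only [outputLaw, Measure.smul_apply, Measure.finsetSum_apply, smul_eq_mul,
    Measure.map_apply measurable_fst hA]
  calc _ ≤ (T : ℝ≥0∞)⁻¹ * ∑ t ∈ Finset.range T,
        (c * stateLaw I f S' t (Prod.fst ⁻¹' A) + δ) := by
        gcongr with t ht
        exact h t (Finset.mem_range.1 ht) _ (measurable_fst hA)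
    _ = c * ((T : ℝ≥0∞)⁻¹ * ∑ t ∈ Finset.range T, stateLaw I f S' t (Prod.fst ⁻¹' A)) +
          (T : ℝ≥0∞) * (T : ℝ≥0∞)⁻¹ * δ := by
        rw [Finset.sum_add_distrib, ← Finset.mul_sum, Finset.sum_const, Finset.card_range,
          nsmul_eq_mul]
        ring
    _ ≤ _ := by
        gcongr
        exact mul_le_of_le_one_left' (ENNReal.mul_inv_le_one _)

end DPTD

end

/-! ### Choice of the Rényi order and conversion to `(ε, δ)`. -/

theorem mainTheorem3 {𝒮 𝒜 : Type*} {d : ℕ} (m n T : ℕ)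
    (f : DPTD.Objective 𝒮 𝒜 d)
    (hf : ∀ ξ, Differentiable ℝ fun x : DPTD.Vec d × DPTD.Vec d => f x.1 x.2 ξ)
    (I : DPTD.Input d) (hI : I.Valid)
    (G : ℝ) (hG : 0 < G) (hLip : DPTD.AveragedLipschitz f I.Θ I.Ω n G)
    (ε δ : ℝ) (hε : 0 < ε) (hδ : 0 < δ)
    (β' α' σsq σ'sq : ℝ) (hβ' : β' ∈ Set.Ioo (0 : ℝ) 1)
    (hα' : α' = Real.log (1 / δ) / ((1 - β') * ε) + 1)
    (hσsq : σsq = 14 * (n : ℝ) ^ 2 * G ^ 2 * T * α' /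
      ((m : ℝ) ^ 2 * (ε - Real.log (1 / δ) / (α' - 1))))
    (hσ : ∀ t, I.σsq t = σsq)
    (hσ'sq : σ'sq = σsq / (4 * (n : ℝ) ^ 2 * G ^ 2))
    (hσ'sq_ge : 0.7 ≤ σ'sq)
    (hα'_le : α' ≤ 2 * σsq * Real.log (n / (α' * (1 + σ'sq))) / 3 + 1) :
    DPTD.IsDPUnderTrajectory
      (fun S : DPTD.Dataset 𝒮 𝒜 m n => DPTD.outputLaw I f T S) ε δ := by
  rintro S S' ⟨i₀, -, huniq⟩ A hA
  refine DPTD.outputLaw_apply_le (fun t ht B hB => ?_) hA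
  -- For `δ ≥ 1` the order `α'` is at most `1` and the moment method does not apply.
  rcases le_or_gt 1 δ with hδ1 | hδ1
  · exact (DPTD.stateLaw_apply_le_one I f S t hB).trans
      ((ENNReal.one_le_ofReal.2 hδ1).trans le_add_self)
  have hS : ∀ i ≠ i₀, S' i = S i := fun i hi => by
    by_contra h
    exact hi (huniq i (Ne.symm h))
  have hτ0 : 0 < σ'sq := by linarith
  have hn0 : (0 : ℝ) < n := by
    rcases Nat.eq_zero_or_pos n with rfl | h
    · simp at hσ'sq
      linarith
    · exact_mod_cast h
  have hv : 0 < σsq := by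
    rw [hσ'sq] at hτ0
    exact (div_pos_iff_of_pos_right (by positivity)).1 hτ0
  have hlog : 0 < Real.log (1 / δ) := Real.log_pos (by rwa [lt_div_iff₀ hδ, one_mul])
  have hβ1 : 0 < 1 - β' := by linarith [hβ'.2]
  have hβ0 : 0 < β' := hβ'.1
  have hα1 : α' - 1 = Real.log (1 / δ) / ((1 - β') * ε) := by rw [hα']; ring
  have hα : 1 < α' := by
    have : 0 < Real.log (1 / δ) / ((1 - β') * ε) := by positivity
    linarith
  have hL : (α' - 1) * ((1 - β') * ε) = Real.log (1 / δ) := by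
    rw [hα1]
    field_simp
  -- Since `α' > 1`, the upper bound on `α'` forces its logarithm to be positive.
  have hn : α' * (1 + σ'sq) ≤ n := by
    have h1 : 0 < Real.log (n / (α' * (1 + σ'sq))) := by
      by_contra! hle
      have : σsq * Real.log (n / (α' * (1 + σ'sq))) ≤ 0 :=
        mul_nonpos_of_nonneg_of_nonpos hv.le hle
      linarith
    have h2 := (Real.log_pos_iff (by positivity)).1 h1
    rw [lt_div_iff₀ (by positivity)] at h2
    linarith
  have hm : (0 : ℝ) < m := by exact_mod_cast i₀.pos
  have hT : (t : ℝ) + 1 ≤ T := by exact_mod_cast ht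
  have hdiv : ε - Real.log (1 / δ) / (α' - 1) = β' * ε := by
    rw [← hL, mul_div_cancel_left₀ _ (by linarith : α' - 1 ≠ 0)]
    ring
  -- The constant `14` in the variance is `3.5 * 4`, the `4` coming from the normalization of `σ'²`.
  have hbudget : T * (3.5 * α' * (m : ℝ)⁻¹ ^ 2 / σ'sq) = β' * ε := by
    have hT0 : (0 : ℝ) < T := by have : (0 : ℝ) ≤ t := t.cast_nonneg; linarith
    rw [hσ'sq, hσsq, hdiv]
    field_simp
    norm_num
  have hclose := DPTD.renyiClose_stateLaw hf hI hG hLip hv hσ hα hσ'sq_ge hσ'sq hn hS t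
  refine (hclose.apply_le hα ε hB).trans ?_
  rw [← ENNReal.ofReal_mul (Real.exp_nonneg _), ← Real.exp_add]
  gcongr
  rw [← Real.le_log_iff_exp_le hδ]
  -- The total exponent is at most `-(α' - 1) ε + (α' - 1) β' ε = -(α' - 1) (1 - β') ε = log δ`.
  have h1 : ((t : ℝ) + 1) * ((α' - 1) * (3.5 * α' * (m : ℝ)⁻¹ ^ 2 / σ'sq)) ≤
      (α' - 1) * (β' * ε) := by
    rw [← hbudget]
    have : 0 ≤ (α' - 1) * (3.5 * α' * (m : ℝ)⁻¹ ^ 2 / σ'sq) :=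
      mul_nonneg (by linarith) (by positivity)
    nlinarith
  have h2 : Real.log (1 / δ) = -Real.log δ := by rw [one_div, Real.log_inv]
  linarith
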